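/- Let $K$ be an arbitrary field, $n$ a positive integer, $Q=(q_1,\dots,q_n)\in(K^*)^n$, and let $\Gamma=(\gamma_{ij})$ be an $n\times n$ matrix with entries in $K^*$ such that $\gamma_{ii}=1$ and $\gamma_{ij}\gamma_{ji}=1$ for all $i,j$. Let $A=A_n^{Q,\Gamma}(K)$ be the multiparameter quantized Weyl algebra, that is, the unital associative $K$-algebra with generators $x_1,y_1,\dots,x_n,y_n$ and defining relations \[ \begin{aligned} y_iy_j&=\gamma_{ij}\,y_jy_i &&\text{for all } i,j,\\ x_ix_j&=q_i\gamma_{ij}\,x_jx_i &&\text{for } i<j,\\ x_iy_j&=\gamma_{ji}\,y_jx_i &&\text{for } i<j,\\ x_iy_j&=q_j\gamma_{ji}\,y_jx_i &&\text{for } i>j,\\ x_jy_j-q_jy_jx_j&=1+\sum_{k=1}^{j-1}(q_k-1)y_kx_k &&\text{for all } j. \end{aligned} \] For $1\le i\le n$ put $z_i=1+\sum_{k=1}^{i}(q_k-1)y_kx_k$ (which equals $x_iy_i-y_ix_i$), and let $(z_i)$ be the two-sided ideal of $A$ generated by $z_i$. Assume that no $q_i$ is a root of unity. Then the set of height one prime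 ideals of $A$ is exactly \[ \{(z_1),(z_2),\dots,(z_n)\}. \] Here a prime ideal is a proper two-sided ideal $P$ such that, for all two-sided ideals $I,J$ of $A$, $IJ\subseteq P$ implies $I\subseteq P$ or $J\subseteq P$, and $P$ has height one if the maximal length $m$ of a chain $P_0\subsetneq P_1\subsetneq\dots\subsetneq P_m=P$ of prime ideals is $1$. -/

import Mathlib

/-- Names of the generators `x₁, …, xₙ, y₁, …, yₙ` (indexed by `Fin n`, i.e. shifted by one). -/
inductive QWeylGen (n : ℕ) : Type
  | x (i : Fin n)
  | y (i : Fin n)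

namespace QWeyl

section Presentation

variable {K : Type*} [Field K] {n : ℕ}

/-- The free generator `xᵢ`. -/
abbrev fx (K : Type*) [Field K] {n : ℕ} (i : Fin n) : FreeAlgebra K (QWeylGen n) :=
  FreeAlgebra.ι K (QWeylGen.x i)

/-- The free generator `yᵢ`. -/
abbrev fy (K : Type*) [Field K] {n : ℕ} (i : Fin n) : FreeAlgebra K (QWeylGen n) :=
  FreeAlgebra.ι K (QWeylGen.y i)

/-- The defining relations of the multiparameter quantized Weyl algebra. -/
inductive Rel (q : Fin n → Kˣ) (γ : Fin n → Fin n → Kˣ) :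
    FreeAlgebra K (QWeylGen n) → FreeAlgebra K (QWeylGen n) → Prop
  | yy (i j : Fin n) :
      Rel q γ (fy K i * fy K j) ((γ i j : K) • (fy K j * fy K i))
  | xx (i j : Fin n) (h : i < j) :
      Rel q γ (fx K i * fx K j) ((q i * γ i j : K) • (fx K j * fx K i))
  | xy_lt (i j : Fin n) (h : i < j) :
      Rel q γ (fx K i * fy K j) ((γ j i : K) • (fy K j * fx K i))
  | xy_gt (i j : Fin n) (h : j < i) :
      Rel q γ (fx K i * fy K j) ((q j * γ j i : K) • (fy K j * fx K i))
  | xy_diag (j : Fin n) :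
      Rel q γ (fx K j * fy K j - (q j : K) • (fy K j * fx K j))
        (1 + ∑ k ∈ Finset.Iio j, (q k - 1 : K) • (fy K k * fx K k))

end Presentation

end QWeyl

/-- The multiparameter quantized Weyl algebra `A_n^{Q,Γ}(K)`: the unital associative `K`-algebra
presented by the generators `xᵢ, yᵢ` and the relations `QWeyl.Rel`. -/
def QWeylAlgebra {K : Type*} [Field K] {n : ℕ} (q : Fin n → Kˣ) (γ : Fin n → Fin n → Kˣ) :
    Type _ :=
  RingQuot (QWeyl.Rel q γ)

namespace QWeylAlgebra

variable {K : Type*} [Field K] {n : ℕ} (q : Fin n → Kˣ) (γ : Fin n → Fin n → Kˣ)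

noncomputable instance : Ring (QWeylAlgebra q γ) :=
  inferInstanceAs (Ring (RingQuot (QWeyl.Rel q γ)))

noncomputable instance : Algebra K (QWeylAlgebra q γ) :=
  inferInstanceAs (Algebra K (RingQuot (QWeyl.Rel q γ)))

/-- The quotient map from the free algebra. -/
noncomputable def mk : FreeAlgebra K (QWeylGen n) →ₐ[K] QWeylAlgebra q γ :=
  RingQuot.mkAlgHom K (QWeyl.Rel q γ)

/-- The generator `xᵢ` of the algebra. -/
noncomputable def x (i : Fin n) : QWeylAlgebra q γ :=
  mk q γ (QWeyl.fx K i)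

/-- The generator `yᵢ` of the algebra. -/
noncomputable def y (i : Fin n) : QWeylAlgebra q γ :=
  mk q γ (QWeyl.fy K i)

/-- The element `zᵢ = 1 + ∑_{k ≤ i} (q_k - 1) y_k x_k`. -/
noncomputable def z (i : Fin n) : QWeylAlgebra q γ :=
  1 + ∑ k ∈ Finset.Iic i, (q k - 1 : K) • (y q γ k * x q γ k)

/-- `zᵢ` is the commutator `[xᵢ, yᵢ]`. -/
theorem z_eq_commutator (i : Fin n) :
    z q γ i = x q γ i * y q γ i - y q γ i * x q γ i := by
  have h : mk q γ _ = mk q γ _ :=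
    RingQuot.mkAlgHom_rel K (QWeyl.Rel.xy_diag (q := q) (γ := γ) i)
  simp only [map_sub, map_add, map_one, map_sum, map_smul, map_mul] at h
  change x q γ i * y q γ i - (q i : K) • (y q γ i * x q γ i) =
    1 + ∑ k ∈ Finset.Iio i, (q k - 1 : K) • (y q γ k * x q γ k) at h
  rw [z, ← Finset.Iio_insert, Finset.sum_insert (by simp), add_left_comm, ← h, sub_smul, one_smul]
  abel

end QWeylAlgebra

/-- A square matrix of nonzero scalars is multiplicatively skew-symmetric. -/
def IsMulSkewSymm {K : Type*} [Field K] {n : ℕ} (γ : Fin n → Fin n → Kˣ) : Prop :=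
  (∀ i, γ i i = 1) ∧ ∀ i j, γ i j * γ j i = 1

namespace TwoSidedIdeal

variable {R : Type*} [Ring R]

/-- A two-sided ideal `P` of a (noncommutative) ring is prime if it is proper and, for all two-sided
ideals `I`, `J`, the inclusion `I J ⊆ P` implies `I ⊆ P` or `J ⊆ P`. (As `P` is closed under sums,
`I J ⊆ P` means that `P` contains all products `a * b` with `a ∈ I`, `b ∈ J`.) -/
def IsPrimeIdeal (P : TwoSidedIdeal R) : Prop :=
  P ≠ ⊤ ∧ ∀ I J : TwoSidedIdeal R, (∀ a ∈ I, ∀ b ∈ J, a * b ∈ P) → I ≤ P ∨ J ≤ P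

/-- A prime two-sided ideal has height one if `1` is the supremum of the lengths of the chains of
prime two-sided ideals descending from it. -/
def IsHeightOnePrime (P : TwoSidedIdeal R) : Prop :=
  ∃ hP : P.IsPrimeIdeal,
    Order.height (⟨P, hP⟩ : {I : TwoSidedIdeal R // I.IsPrimeIdeal}) = 1

end TwoSidedIdeal

/-! The `z_i` commute with one another, and each commutes with every generator up to a nonzero
scalar. Let `D` be the polynomial ring in the `z_i`. Sending `y_j` to the degree-`e_j` unit and
`x_j` to `(x_j y_j) y_j⁻¹`, with `x_j y_j` linear in the `z`'s, maps `A` to a twisted crossed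
product `D ⋊ ℤⁿ`. Over `D`, `A` is spanned by ordered words, one for each degree in `ℤⁿ`, whose
images are homogeneous with coefficients divisible by no `z_l`. Hence the map is injective
(`toCrossed_injective`), and divisibility by `z_i` in `A` can be tested on coefficients in the
crossed product (`exists_eq_z_mul`). As `ℤⁿ` has unique sums, both `0` and every `(z_i)` are
completely prime (`dvd_coeff_or_dvd_coeff`).

It remains to see that a nonzero prime `P` contains some `z_i`; the height one primes are then
forced by `setOf_isHeightOnePrime_eq_range`. Since no `q_i` is a root of unity, the `z_i` act by
conjugation with distinct characters on distinct degrees, so a shortest nonzero element of `P` is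
homogeneous, and multiplying by a word of opposite degree gives a nonzero polynomial in the `z`'s
(`exists_ofPoly_mem`). Suppose no `z_i` lies in `P`. Each `z_i` is normal, hence regular modulo `P`.
The `y_j` separate the monomials of `D`, so twisted commutators with `y_j` shorten the polynomial at
the cost of a power of `y_j` on the right; commutators with `x_j` remove that power again
(`ofPoly_mem_of_act_eq`). One ends with a monomial in the `z`'s inside `P`, and regularity gives `1
∈ P`, a contradiction (`ofPoly_mul_y_pow_notMem`). -/

/-! ### Twisted crossed products and their completely prime ideals -/

/-- The data of a twisted crossed product `D ⋊ G` over a field `K`: an action of the additive group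
`G` on the commutative `K`-algebra `D` and a `Kˣ`-valued bimultiplicative cocycle on `G`. -/
structure CrossedData (K G D : Type*) [Field K] [AddCommGroup G] [CommRing D] [Algebra K D] where
  /-- the action -/
  act : G → D →ₐ[K] D
  act_zero : act 0 = AlgHom.id K D
  act_add : ∀ g h c, act (g + h) c = act g (act h c)
  /-- the cocycle -/
  coc : G → G → Kˣ
  coc_add_left : ∀ g h k, coc (g + h) k = coc g k * coc h k
  coc_add_right : ∀ g h k, coc g (h + k) = coc g h * coc g k

/-- The twisted crossed product: finite sums `∑ c_g u^g` with `c_g ∈ D`, multiplied by the rule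
`c u^g * b u^h = coc g h • (c * act g b) u^(g + h)`. -/
def CrossedProduct {K G D : Type*} [Field K] [AddCommGroup G] [CommRing D] [Algebra K D]
    (_ : CrossedData K G D) : Type _ := G →₀ D

namespace CrossedData

variable {K G D : Type*} [Field K] [AddCommGroup G] [CommRing D] [Algebra K D]
  (S : CrossedData K G D)

theorem coc_zero_left (g : G) : S.coc 0 g = 1 := by
  have h := S.coc_add_left 0 0 g
  rwa [add_zero, left_eq_mul] at h

theorem coc_zero_right (g : G) : S.coc g 0 = 1 := by
  have h := S.coc_add_right g 0 0
  rwa [add_zero, left_eq_mul] at h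

theorem coc_neg_left (g h : G) : S.coc (-g) h = (S.coc g h)⁻¹ := by
  rw [eq_inv_iff_mul_eq_one, ← S.coc_add_left, neg_add_cancel, coc_zero_left]

theorem coc_neg_right (g h : G) : S.coc g (-h) = (S.coc g h)⁻¹ := by
  rw [eq_inv_iff_mul_eq_one, ← S.coc_add_right, neg_add_cancel, coc_zero_right]

theorem act_neg_act (g : G) (c : D) : S.act (-g) (S.act g c) = c := by
  rw [← S.act_add, neg_add_cancel, S.act_zero, AlgHom.id_apply]

theorem act_act_neg (g : G) (c : D) : S.act g (S.act (-g) c) = c := by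
  rw [← S.act_add, add_neg_cancel, S.act_zero, AlgHom.id_apply]

theorem act_injective (g : G) : Function.Injective (S.act g) :=
  Function.LeftInverse.injective (S.act_neg_act g)

end CrossedData

namespace CrossedProduct

variable {K G D : Type*} [Field K] [AddCommGroup G] [CommRing D] [Algebra K D]
  {S : CrossedData K G D}

noncomputable instance : AddCommGroup (CrossedProduct S) := inferInstanceAs (AddCommGroup (G →₀ D))

noncomputable instance : Module K (CrossedProduct S) := inferInstanceAs (Module K (G →₀ D))

/-- The coefficient function of an element. -/
noncomputable def coeff : CrossedProduct S ≃ₗ[K] (G →₀ D) := LinearEquiv.refl K (G →₀ D)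

/-- The homogeneous element `c u^g`. -/
noncomputable def single (g : G) (c : D) : CrossedProduct S := coeff.symm (Finsupp.single g c)

@[simp] theorem coeff_single (g : G) (c : D) :
    coeff (single g c : CrossedProduct S) = Finsupp.single g c := rfl

@[simp] theorem single_zero (g : G) : (single g 0 : CrossedProduct S) = 0 :=
  Finsupp.single_zero g

theorem single_add (g : G) (c d : D) :
    (single g (c + d) : CrossedProduct S) = single g c + single g d := Finsupp.single_add g c d

theorem smul_single (k : K) (g : G) (c : D) :
    k • (single g c : CrossedProduct S) = single g (k • c) := Finsupp.smul_single k g c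

theorem induction_on {p : CrossedProduct S → Prop} (s : CrossedProduct S) (zero : p 0)
    (add : ∀ s t, p s → p t → p (s + t)) (single : ∀ g c, p (single g c)) : p s :=
  Finsupp.induction_linear (motive := p) s zero add single

noncomputable instance : Mul (CrossedProduct S) where
  mul s t := (coeff s).sum fun g c ↦ (coeff t).sum fun h b ↦
    single (g + h) (S.coc g h • (c * S.act g b))

noncomputable instance : One (CrossedProduct S) where
  one := single 0 1

theorem one_def : (1 : CrossedProduct S) = single 0 1 := rfl

theorem mul_def (s t : CrossedProduct S) : s * t = (coeff s).sum fun g c ↦ (coeff t).sum fun h b ↦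
    single (g + h) (S.coc g h • (c * S.act g b)) := rfl

theorem single_mul_single (g h : G) (c b : D) : (single g c * single h b : CrossedProduct S) =
    single (g + h) (S.coc g h • (c * S.act g b)) := by
  rw [mul_def, coeff_single, coeff_single, Finsupp.sum_single_index, Finsupp.sum_single_index] <;>
    simp

protected theorem zero_mul (s : CrossedProduct S) : 0 * s = 0 := by
  rw [mul_def, map_zero, Finsupp.sum_zero_index]

protected theorem mul_zero (s : CrossedProduct S) : s * 0 = 0 := by
  simp [mul_def]

protected theorem mul_add (s t u : CrossedProduct S) : s * (t + u) = s * t + s * u := by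
  simp only [mul_def, map_add, ← Finsupp.sum_add]
  refine Finsupp.sum_congr fun g _ ↦ Finsupp.sum_add_index' (by simp) fun h b c ↦ ?_
  rw [map_add, mul_add, smul_add, single_add]

protected theorem add_mul (s t u : CrossedProduct S) : (s + t) * u = s * u + t * u := by
  simp only [mul_def, map_add]
  refine Finsupp.sum_add_index' (by simp) fun g b c ↦ ?_
  rw [← Finsupp.sum_add]
  refine Finsupp.sum_congr fun h _ ↦ ?_
  rw [add_mul, smul_add, single_add]

protected theorem mul_assoc (s t u : CrossedProduct S) : s * t * u = s * (t * u) := by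
  induction s using induction_on with
  | zero => simp only [CrossedProduct.zero_mul]
  | add s s' hs hs' => simp only [CrossedProduct.add_mul, hs, hs']
  | single g a =>
  induction t using induction_on with
  | zero => simp only [CrossedProduct.zero_mul, CrossedProduct.mul_zero]
  | add t t' ht ht' => simp only [CrossedProduct.add_mul, CrossedProduct.mul_add, ht, ht']
  | single h b =>
  induction u using induction_on with
  | zero => simp only [CrossedProduct.mul_zero]
  | add u u' hu hu' => simp only [CrossedProduct.mul_add, hu, hu']
  | single k c =>
    simp only [single_mul_single, add_assoc, Units.smul_def, map_smul, map_mul, S.act_add,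
      S.coc_add_left, S.coc_add_right, smul_mul_assoc, mul_smul_comm, smul_smul, mul_assoc,
      Units.val_mul]
    congr 2
    ring

noncomputable instance : Ring (CrossedProduct S) where
  __ := (inferInstance : AddCommGroup (CrossedProduct S))
  left_distrib := CrossedProduct.mul_add
  right_distrib := CrossedProduct.add_mul
  zero_mul := CrossedProduct.zero_mul
  mul_zero := CrossedProduct.mul_zero
  mul_assoc := CrossedProduct.mul_assoc
  one_mul s := by
    induction s using induction_on with
    | zero => rw [CrossedProduct.mul_zero]
    | add s t hs ht => rw [CrossedProduct.mul_add, hs, ht]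
    | single g c => simp [one_def, single_mul_single, S.coc_zero_left, S.act_zero]
  mul_one s := by
    induction s using induction_on with
    | zero => rw [CrossedProduct.zero_mul]
    | add s t hs ht => rw [CrossedProduct.add_mul, hs, ht]
    | single g c => simp [one_def, single_mul_single, S.coc_zero_right]

noncomputable instance : Algebra K (CrossedProduct S) := Algebra.ofModule
  (fun k s t ↦ by
    induction s using induction_on with
    | zero => simp
    | add s s' hs hs' => simp only [add_mul, smul_add, hs, hs']
    | single g c =>
    induction t using induction_on with
    | zero => simp
    | add t t' ht ht' => simp only [mul_add, smul_add, ht, ht']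
    | single h b =>
      simp only [smul_single, single_mul_single, smul_mul_assoc]
      rw [smul_comm])
  (fun k s t ↦ by
    induction s using induction_on with
    | zero => simp
    | add s s' hs hs' => simp only [add_mul, smul_add, hs, hs']
    | single g c =>
    induction t using induction_on with
    | zero => simp
    | add t t' ht ht' => simp only [mul_add, smul_add, ht, ht']
    | single h b =>
      simp only [smul_single, single_mul_single, map_smul, mul_smul_comm]
      rw [smul_comm])

/-- The inclusion of the coefficient ring in degree zero. -/
noncomputable def C : D →ₐ[K] CrossedProduct S :=
  AlgHom.ofLinearMap ((coeff (S := S)).symm.toLinearMap ∘ₗ Finsupp.lsingle 0) rfl fun c b ↦ by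
    change (single 0 (c * b) : CrossedProduct S) = single 0 c * single 0 b
    simp [single_mul_single, S.coc_zero_left, S.act_zero]

theorem C_apply (c : D) : (C c : CrossedProduct S) = single 0 c := rfl

theorem C_mul_single (g : G) (c b : D) :
    (C c * single g b : CrossedProduct S) = single g (c * b) := by
  simp [C_apply, single_mul_single, S.coc_zero_left, S.act_zero]

theorem single_mul_C (g : G) (c b : D) :
    (single g b * C c : CrossedProduct S) = single g (b * S.act g c) := by
  simp [C_apply, single_mul_single, S.coc_zero_right]

theorem coeff_C_mul (s : CrossedProduct S) (c : D) (g : G) :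
    coeff (C c * s) g = c * coeff s g := by
  induction s using induction_on with
  | zero => simp
  | add s t hs ht => rw [mul_add, map_add, Finsupp.add_apply, hs, ht, map_add, Finsupp.add_apply,
      mul_add]
  | single h b =>
    classical
    rw [C_mul_single, coeff_single, coeff_single, Finsupp.single_apply, Finsupp.single_apply]
    split_ifs <;> simp

/-- The twist by `act g`, absent from multiplication on the left, is what lets commutators with
elements of `D` tell the degrees of `s` apart. -/
theorem coeff_mul_C (s : CrossedProduct S) (c : D) (g : G) :
    coeff (s * C c) g = coeff s g * S.act g c := by
  induction s using induction_on with
  | zero => simp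
  | add s t hs ht => rw [add_mul, map_add, Finsupp.add_apply, hs, ht, map_add, Finsupp.add_apply,
      add_mul]
  | single h b =>
    classical
    rw [single_mul_C, coeff_single, coeff_single, Finsupp.single_apply, Finsupp.single_apply]
    split_ifs with h
    · rw [h]
    · simp

theorem coeff_mul [DecidableEq G] (s t : CrossedProduct S) (k : G) :
    coeff (s * t) k = ∑ g ∈ (coeff s).support, ∑ h ∈ (coeff t).support,
      if g + h = k then S.coc g h • (coeff s g * S.act g (coeff t h)) else 0 := by
  rw [mul_def, Finsupp.sum, map_sum, Finsupp.finsetSum_apply]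
  refine Finset.sum_congr rfl fun g _ ↦ ?_
  rw [Finsupp.sum, map_sum, Finsupp.finsetSum_apply]
  refine Finset.sum_congr rfl fun h _ ↦ ?_
  rw [coeff_single, Finsupp.single_apply]

/-- If `p` divides all coefficients of `t`, then it divides those of `s * t` as well, provided that
the action preserves divisibility by `p`. -/
theorem dvd_coeff_mul {p : D} (hp : ∀ g c, p ∣ c → p ∣ S.act g c) {s t : CrossedProduct S}
    (h : (∀ g, p ∣ coeff s g) ∨ ∀ g, p ∣ coeff t g) (k : G) : p ∣ coeff (s * t) k := by
  classical
  rw [coeff_mul]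
  refine Finset.dvd_sum fun g _ ↦ Finset.dvd_sum fun g' _ ↦ ?_
  split_ifs
  · rw [Units.smul_def]
    refine dvd_smul_of_dvd _ ?_
    exact h.elim (fun h ↦ (h g).mul_right _) fun h ↦ (hp _ _ (h g')).mul_left _
  · exact dvd_zero p

/-- In a twisted crossed product with a group whose finite subsets have unique sums, the set of
elements with all coefficients in a stable principal prime ideal is completely prime. -/
theorem dvd_coeff_or_dvd_coeff [UniqueSums G] {p : D} (hprime : ∀ a b, p ∣ a * b → p ∣ a ∨ p ∣ b)
    (hp : ∀ g c, p ∣ c → p ∣ S.act g c) {s t : CrossedProduct S} (h : ∀ g, p ∣ coeff (s * t) g) :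
    (∀ g, p ∣ coeff s g) ∨ ∀ g, p ∣ coeff t g := by
  classical
  by_contra! hc
  obtain ⟨⟨g₁, hg₁⟩, g₂, hg₂⟩ := hc
  have mem {u : CrossedProduct S} {g : G} (hg : ¬ p ∣ coeff u g) : g ∈ (coeff u).support := by
    rw [Finsupp.mem_support_iff]
    exact fun h0 ↦ hg (h0 ▸ dvd_zero p)
  -- Only degrees with coefficient not divisible by `p` are kept. At a unique sum `a + b` of these,
  -- all other contributions to the coefficient of `s * t` are divisible by `p`, so the remaining
  -- one is too.
  obtain ⟨a, ha, b, hb, hab⟩ := UniqueSums.uniqueAdd_of_nonempty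
    (A := (coeff s).support.filter fun g ↦ ¬ p ∣ coeff s g)
    (B := (coeff t).support.filter fun g ↦ ¬ p ∣ coeff t g)
    ⟨g₁, Finset.mem_filter.2 ⟨mem hg₁, hg₁⟩⟩ ⟨g₂, Finset.mem_filter.2 ⟨mem hg₂, hg₂⟩⟩
  rw [Finset.mem_filter] at ha hb
  have key := h (a + b)
  have other : ∀ g h, (g ≠ a ∨ h ≠ b) →
      p ∣ if g + h = a + b then S.coc g h • (coeff s g * S.act g (coeff t h)) else 0 := by
    intro g h hgh
    split_ifs with heq
    · rw [Units.smul_def]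
      refine dvd_smul_of_dvd _ ?_
      by_cases hg : p ∣ coeff s g
      · exact hg.mul_right _
      by_cases hh : p ∣ coeff t h
      · exact (hp _ _ hh).mul_left _
      have := hab (Finset.mem_filter.2 ⟨mem hg, hg⟩) (Finset.mem_filter.2 ⟨mem hh, hh⟩) heq
      tauto
    · exact dvd_zero p
  rw [coeff_mul, ← Finset.add_sum_erase _ _ ha.1, ← Finset.add_sum_erase _ _ hb.1, if_pos rfl,
    add_assoc] at key
  rw [dvd_add_left] at key
  · rw [Units.smul_def] at key
    have key' := dvd_smul_of_dvd ((S.coc a b)⁻¹ : Kˣ).val key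
    rw [smul_smul, ← Units.val_mul, inv_mul_cancel, Units.val_one, one_smul] at key'
    obtain h1 | h1 := hprime _ _ key'
    · exact ha.2 h1
    · have := hp (-a) _ h1
      rw [S.act_neg_act] at this
      exact hb.2 this
  · refine dvd_add (Finset.dvd_sum fun h hh ↦ other _ _ (.inr (Finset.ne_of_mem_erase hh))) ?_
    exact Finset.dvd_sum fun g hg ↦ Finset.dvd_sum fun h _ ↦
      other _ _ (.inl (Finset.ne_of_mem_erase hg))

end CrossedProduct

/-! ### The crossed product attached to `Q` and `Γ` -/

namespace QWeyl

variable {K : Type*} [Field K] {n : ℕ} (q : Fin n → Kˣ) (γ : Fin n → Fin n → Kˣ)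

/-- The scalar by which the degree `d` monomial in the `yᵢ` acts on `z_k` by conjugation. -/
def weight (d : Fin n → ℤ) (k : ℕ) : Kˣ :=
  ∏ j ∈ Finset.univ.filter fun j : Fin n ↦ j.val < k, q j ^ (-d j)

theorem weight_zero_left (k : ℕ) : weight q 0 k = 1 := by simp [weight]

theorem weight_zero_right (d : Fin n → ℤ) : weight q d 0 = 1 := by simp [weight]

theorem weight_add (d e : Fin n → ℤ) (k : ℕ) :
    weight q (d + e) k = weight q d k * weight q e k := by
  rw [weight, weight, weight, ← Finset.prod_mul_distrib]
  refine Finset.prod_congr rfl fun j _ ↦ ?_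
  rw [← zpow_add, Pi.add_apply, neg_add]

theorem weight_neg (d : Fin n → ℤ) (k : ℕ) : weight q (-d) k = (weight q d k)⁻¹ := by
  rw [eq_inv_iff_mul_eq_one, ← weight_add, neg_add_cancel, weight_zero_left]

theorem filter_lt_succ (i : Fin n) : (Finset.univ.filter fun j : Fin n ↦ j.val < i.val + 1) =
    insert i (Finset.univ.filter fun j : Fin n ↦ j.val < i.val) := by
  ext j
  simp only [Finset.mem_filter, Finset.mem_univ, true_and, Finset.mem_insert, Fin.ext_iff]
  omega

theorem weight_succ (d : Fin n → ℤ) (i : Fin n) :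
    weight q d (i.val + 1) = q i ^ (-d i) * weight q d i := by
  rw [weight, filter_lt_succ, Finset.prod_insert (by simp), weight]

theorem weight_single (j : Fin n) (k : ℕ) :
    weight q (Pi.single j 1) k = if j.val < k then (q j)⁻¹ else 1 := by
  rw [weight]
  split_ifs with h
  · rw [Finset.prod_eq_single_of_mem j (by simpa using h)]
    · simp
    · intro i _ hij
      simp [Pi.single_eq_of_ne hij]
  · refine Finset.prod_eq_one fun i hi ↦ ?_
    have : i ≠ j := by rintro rfl; simp at hi; omega
    simp [Pi.single_eq_of_ne this]

/-- The cocycle describing the commutation of the ordered monomials in the `yᵢ`. -/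
def cocycle (d e : Fin n → ℤ) : Kˣ := ∏ i, ∏ j ∈ Finset.Iio i, γ i j ^ (d i * e j)

theorem cocycle_single (i j : Fin n) :
    cocycle γ (Pi.single i 1) (Pi.single j 1) = if j < i then γ i j else 1 := by
  rw [cocycle, Finset.prod_eq_single_of_mem i (Finset.mem_univ i)]
  · split_ifs with h
    · rw [Finset.prod_eq_single_of_mem j (by simpa using h)]
      · simp
      · intro k _ hk
        simp [Pi.single_eq_of_ne hk]
    · refine Finset.prod_eq_one fun k hk ↦ ?_
      have : k ≠ j := by rintro rfl; simp at hk; contradiction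
      simp [Pi.single_eq_of_ne this]
  · intro k _ hk
    simp [Pi.single_eq_of_ne hk]

/-- The data of the localization of the quantized Weyl algebra at the `yᵢ`. -/
noncomputable def crossedData : CrossedData K (Fin n → ℤ) (MvPolynomial (Fin n) K) where
  act d := MvPolynomial.aeval fun i : Fin n ↦ (weight q d (i.val + 1) : K) • MvPolynomial.X i
  act_zero := by
    ext i
    simp [weight_zero_left]
  act_add d e c := by
    rw [← AlgHom.comp_apply]
    congr 1
    ext i
    simp [weight_add, smul_smul, mul_comm]
  coc := cocycle γ
  coc_add_left d e f := by
    simp only [cocycle, ← Finset.prod_mul_distrib, ← zpow_add, Pi.add_apply, add_mul]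
  coc_add_right d e f := by
    simp only [cocycle, ← Finset.prod_mul_distrib, ← zpow_add, Pi.add_apply, mul_add]

variable (K n) in
/-- The polynomial representing `z_k`, with the conventions `z_0 = 1` and `z_1` for the first of
the generators. -/
noncomputable def zPoly : ℕ → MvPolynomial (Fin n) K
  | 0 => 1
  | k + 1 => if h : k < n then MvPolynomial.X ⟨k, h⟩ else 0

theorem zPoly_zero : zPoly K n 0 = 1 := rfl

theorem zPoly_succ (i : Fin n) : zPoly K n (i.val + 1) = MvPolynomial.X i := by
  simp [zPoly]

theorem act_X (d : Fin n → ℤ) (i : Fin n) : (crossedData q γ).act d (MvPolynomial.X i) =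
    (weight q d (i.val + 1) : K) • MvPolynomial.X i :=
  MvPolynomial.aeval_X _ _

theorem act_zPoly (d : Fin n → ℤ) (k : ℕ) :
    (crossedData q γ).act d (zPoly K n k) = (weight q d k : K) • zPoly K n k := by
  cases k with
  | zero => simp [zPoly, weight_zero_right]
  | succ k =>
    rw [zPoly]
    split_ifs with h
    · exact act_X q γ d ⟨k, h⟩
    · simp

end QWeyl

/-! ### Commutation of the `z`'s with the generators -/

namespace QWeylAlgebra

open QWeyl

variable {K : Type*} [Field K] {n : ℕ} {q : Fin n → Kˣ} {γ : Fin n → Fin n → Kˣ}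

theorem mk_surjective : Function.Surjective (mk q γ) := RingQuot.mkAlgHom_surjective _ _

theorem y_mul_y (i j : Fin n) : y q γ i * y q γ j = (γ i j : K) • (y q γ j * y q γ i) := by
  have h : mk q γ _ = mk q γ _ := RingQuot.mkAlgHom_rel K (Rel.yy (q := q) (γ := γ) i j)
  rw [map_smul, map_mul, map_mul] at h
  exact h

theorem x_mul_x {i j : Fin n} (hij : i < j) :
    x q γ i * x q γ j = (q i * γ i j : K) • (x q γ j * x q γ i) := by
  have h : mk q γ _ = mk q γ _ := RingQuot.mkAlgHom_rel K (Rel.xx (q := q) (γ := γ) i j hij)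
  rw [map_smul, map_mul, map_mul] at h
  exact h

theorem x_mul_y_of_lt {i j : Fin n} (hij : i < j) :
    x q γ i * y q γ j = (γ j i : K) • (y q γ j * x q γ i) := by
  have h : mk q γ _ = mk q γ _ := RingQuot.mkAlgHom_rel K (Rel.xy_lt (q := q) (γ := γ) i j hij)
  rw [map_smul, map_mul, map_mul] at h
  exact h

theorem x_mul_y_of_gt {i j : Fin n} (hij : j < i) :
    x q γ i * y q γ j = (q j * γ j i : K) • (y q γ j * x q γ i) := by
  have h : mk q γ _ = mk q γ _ := RingQuot.mkAlgHom_rel K (Rel.xy_gt (q := q) (γ := γ) i j hij)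
  rw [map_smul, map_mul, map_mul] at h
  exact h

variable (q γ) in
/-- The element `1 + ∑_{i < k} (q_i - 1) y_i x_i`, that is `z_k` with the convention that `z_0 = 1`
and `z_1` is the first of the generators. -/
noncomputable def zNat (k : ℕ) : QWeylAlgebra q γ :=
  1 + ∑ i ∈ Finset.univ.filter fun i : Fin n ↦ i.val < k, (q i - 1 : K) • (y q γ i * x q γ i)

theorem zNat_zero : zNat q γ 0 = 1 := by simp [zNat]

theorem zNat_succ (i : Fin n) :
    zNat q γ (i.val + 1) = zNat q γ i + (q i - 1 : K) • (y q γ i * x q γ i) := by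
  rw [zNat, filter_lt_succ, Finset.sum_insert (by simp), add_left_comm, add_comm, zNat]

theorem z_eq_zNat (i : Fin n) : z q γ i = zNat q γ (i.val + 1) := by
  rw [z, zNat]
  have : Finset.Iic i = Finset.univ.filter fun j : Fin n ↦ j.val < i.val + 1 := by
    ext j
    rw [Finset.mem_Iic, Finset.mem_filter, Fin.le_def, Nat.lt_succ_iff]
    exact ⟨fun h ↦ ⟨Finset.mem_univ j, h⟩, fun h ↦ h.2⟩
  rw [this]

theorem x_mul_y_self (i : Fin n) :
    x q γ i * y q γ i = (q i : K) • (y q γ i * x q γ i) + zNat q γ i := by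
  have h := z_eq_commutator q γ i
  rw [z_eq_zNat, zNat_succ] at h
  rw [eq_sub_iff_add_eq, sub_smul, one_smul] at h
  rw [← h]
  abel

@[elab_as_elim]
theorem induction_on {p : QWeylAlgebra q γ → Prop} (a : QWeylAlgebra q γ)
    (algebraMap : ∀ k : K, p (algebraMap K _ k)) (x : ∀ i, p (x q γ i)) (y : ∀ i, p (y q γ i))
    (add : ∀ a b, p a → p b → p (a + b)) (mul : ∀ a b, p a → p b → p (a * b)) : p a := by
  obtain ⟨a, rfl⟩ := mk_surjective a
  induction a using FreeAlgebra.induction with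
  | grade0 k => rw [AlgHom.commutes]; exact algebraMap k
  | grade1 g =>
    cases g with
    | x i => exact x i
    | y i => exact y i
  | mul a b ha hb => rw [map_mul]; exact mul _ _ ha hb
  | add a b ha hb => rw [map_add]; exact add _ _ ha hb

theorem y_mul_x_of_lt {i j : Fin n} (hij : i < j) :
    y q γ i * x q γ j = (q i * γ i j : K)⁻¹ • (x q γ j * y q γ i) := by
  rw [x_mul_y_of_gt hij, smul_smul, inv_mul_cancel₀ (by simp), one_smul]

theorem y_mul_x_of_gt {i j : Fin n} (hij : j < i) :
    y q γ i * x q γ j = (γ i j : K)⁻¹ • (x q γ j * y q γ i) := by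
  rw [x_mul_y_of_lt hij, smul_smul, inv_mul_cancel₀ (by simp), one_smul]

theorem x_mul_x_of_gt {i j : Fin n} (hij : j < i) :
    x q γ i * x q γ j = (q j * γ j i : K)⁻¹ • (x q γ j * x q γ i) := by
  rw [x_mul_x hij, smul_smul, inv_mul_cancel₀ (by simp), one_smul]

/-- The factors of `γ` from passing `y_i` and `x_i` cancel, so only a power of `q_j` survives, and
it appears only for `j < i`. -/
theorem y_mul_yx {i j : Fin n} (hij : i ≠ j) : y q γ j * (y q γ i * x q γ i) =
    (weight q (Pi.single j 1) (i.val + 1) : K) • (y q γ i * x q γ i * y q γ j) := by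
  have hγ' : (γ j i : K) ≠ 0 := by simp
  rw [weight_single, ← mul_assoc, y_mul_y, smul_mul_assoc, mul_assoc]
  rcases lt_or_gt_of_ne hij with h | h
  · rw [y_mul_x_of_gt h, mul_smul_comm, smul_smul, mul_inv_cancel₀ hγ', if_neg (by omega),
      mul_assoc, Units.val_one]
  · rw [y_mul_x_of_lt h, mul_smul_comm, smul_smul, if_pos (by omega), mul_assoc,
      Units.val_inv_eq_inv_val]
    congr 1
    field_simp

theorem yx_mul_x (hγ : IsMulSkewSymm γ) {i j : Fin n} (hij : i ≠ j) :
    y q γ i * x q γ i * x q γ j =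
      (weight q (Pi.single j 1) (i.val + 1) : K) • (x q γ j * (y q γ i * x q γ i)) := by
  have hγ' : (γ j i : K) * γ i j = 1 := by rw [← Units.val_mul, hγ.2 j i, Units.val_one]
  have hq : (q i : K) ≠ 0 := by simp
  rw [weight_single, mul_assoc, ← mul_assoc (x q γ j)]
  rcases lt_or_gt_of_ne hij with h | h
  · have hγ'' : (γ i j : K) ≠ 0 := by simp
    rw [x_mul_x h, mul_smul_comm, ← mul_assoc, y_mul_x_of_lt h, smul_mul_assoc, smul_smul,
      mul_inv_cancel₀ (mul_ne_zero hq hγ''), if_neg (by omega), Units.val_one]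
  · rw [x_mul_x_of_gt h, mul_smul_comm, ← mul_assoc, y_mul_x_of_gt h, smul_mul_assoc, smul_smul,
      if_pos (by omega), Units.val_inv_eq_inv_val, ← mul_inv, mul_assoc, hγ', mul_one]

theorem y_mul_zNat (j : Fin n) {k : ℕ} (hk : k ≤ n) : y q γ j * zNat q γ k =
    (weight q (Pi.single j 1) k : K) • (zNat q γ k * y q γ j) := by
  induction k with
  | zero => simp [zNat_zero, weight_zero_right]
  | succ k ih =>
    specialize ih (by omega)
    obtain ⟨i, rfl⟩ : ∃ i : Fin n, i.val = k := ⟨⟨k, hk⟩, rfl⟩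
    by_cases hij : i = j
    · subst hij
      -- The previous `z` equals `x_i y_i - q_i y_i x_i` and commutes with `y_i`, as its weight is
      -- 1. Rearranged, this is exactly the `q_i`-commutation of `y_i` with `x_i y_i - y_i x_i`, the
      -- next `z`.
      have h1 : y q γ i * zNat q γ i = zNat q γ i * y q γ i := by
        rw [ih, weight_single, if_neg (lt_irrefl _), Units.val_one, one_smul]
      rw [eq_sub_of_add_eq' (x_mul_y_self i).symm, mul_sub, sub_mul, mul_smul_comm,
        smul_mul_assoc] at h1
      rw [← z_eq_zNat, z_eq_commutator, weight_single, if_pos (Nat.lt_succ_self _),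
        Units.val_inv_eq_inv_val, eq_inv_smul_iff₀ (by simp), mul_sub, sub_mul]
      simp only [← mul_assoc] at h1 ⊢
      linear_combination (norm := module) h1
    · have hw : weight q (Pi.single j 1) i.val = weight q (Pi.single j 1) (i.val + 1) := by
        rw [weight_single, weight_single]
        have := Fin.val_ne_of_ne hij
        congr 1
        exact propext (by omega)
      rw [zNat_succ, mul_add, add_mul, ih, mul_smul_comm, y_mul_yx hij, smul_mul_assoc, smul_add,
        hw, smul_comm]

theorem zNat_mul_x (hγ : IsMulSkewSymm γ) (j : Fin n) {k : ℕ} (hk : k ≤ n) :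
    zNat q γ k * x q γ j = (weight q (Pi.single j 1) k : K) • (x q γ j * zNat q γ k) := by
  induction k with
  | zero => simp [zNat_zero, weight_zero_right]
  | succ k ih =>
    specialize ih (by omega)
    obtain ⟨i, rfl⟩ : ∃ i : Fin n, i.val = k := ⟨⟨k, hk⟩, rfl⟩
    by_cases hij : i = j
    · subst hij
      have h1 : zNat q γ i * x q γ i = x q γ i * zNat q γ i := by
        rw [ih, weight_single, if_neg (lt_irrefl _), Units.val_one, one_smul]
      rw [eq_sub_of_add_eq' (x_mul_y_self i).symm, mul_sub, sub_mul, mul_smul_comm,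
        smul_mul_assoc] at h1
      rw [← z_eq_zNat, z_eq_commutator, weight_single, if_pos (Nat.lt_succ_self _),
        Units.val_inv_eq_inv_val, eq_inv_smul_iff₀ (by simp), mul_sub, sub_mul]
      simp only [← mul_assoc] at h1 ⊢
      linear_combination (norm := module) h1
    · have hw : weight q (Pi.single j 1) i.val = weight q (Pi.single j 1) (i.val + 1) := by
        rw [weight_single, weight_single]
        have := Fin.val_ne_of_ne hij
        congr 1
        exact propext (by omega)
      rw [zNat_succ, mul_add, add_mul, ih, mul_smul_comm, smul_mul_assoc, yx_mul_x hγ hij, smul_add,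
        hw, smul_comm]

end QWeylAlgebra

/-! ### Polynomials in the `z`'s and the spanning set of ordered words -/

namespace QWeylAlgebra

open QWeyl

variable {K : Type*} [Field K] {n : ℕ} {q : Fin n → Kˣ} {γ : Fin n → Fin n → Kˣ}

/-- The scalars picked up in passing `y_i` and `x_i` are mutually inverse. -/
theorem zNat_commute_yx (hγ : IsMulSkewSymm γ) (i : Fin n) {k : ℕ} (hk : k ≤ n) :
    Commute (zNat q γ k) (y q γ i * x q γ i) := by
  have h := y_mul_zNat (γ := γ) (q := q) i hk
  rw [← inv_smul_eq_iff₀ (by simp)] at h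
  rw [Commute, SemiconjBy, ← mul_assoc, ← h, smul_mul_assoc, mul_assoc, zNat_mul_x hγ i hk,
    mul_smul_comm, smul_smul, inv_mul_cancel₀ (by simp), one_smul, mul_assoc]

theorem z_commute (hγ : IsMulSkewSymm γ) (i j : Fin n) : Commute (z q γ i) (z q γ j) := by
  rw [z_eq_zNat i]
  refine (Commute.one_right _).add_right (Commute.sum_right _ _ _ fun k _ ↦ ?_)
  exact (zNat_commute_yx hγ k i.isLt).smul_right _

theorem adjoin_z_comm (hγ : IsMulSkewSymm γ) : ∀ a ∈ Set.range (z q γ), ∀ b ∈ Set.range (z q γ),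
    a * b = b * a := by
  rintro _ ⟨i, rfl⟩ _ ⟨j, rfl⟩
  exact z_commute hγ i j

open scoped IsMulCommutative in
/-- Evaluation of polynomials at the commuting elements `zᵢ`. -/
noncomputable def ofPoly (hγ : IsMulSkewSymm γ) :
    MvPolynomial (Fin n) K →ₐ[K] QWeylAlgebra q γ :=
  haveI := Algebra.isMulCommutative_adjoin K (adjoin_z_comm (q := q) hγ)
  (Algebra.adjoin K (Set.range (z q γ))).val.comp
    (MvPolynomial.aeval (S₁ := Algebra.adjoin K (Set.range (z q γ)))
      fun i ↦ ⟨z q γ i, Algebra.subset_adjoin ⟨i, rfl⟩⟩)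

variable {hγ : IsMulSkewSymm γ}

open scoped IsMulCommutative in
theorem ofPoly_X (i : Fin n) : ofPoly hγ (MvPolynomial.X i) = z q γ i := by
  simp [ofPoly]

theorem ofPoly_zPoly {k : ℕ} (hk : k ≤ n) : ofPoly hγ (zPoly K n k) = zNat q γ k := by
  cases k with
  | zero => rw [zPoly_zero, map_one, zNat_zero]
  | succ k =>
    obtain ⟨i, rfl⟩ : ∃ i : Fin n, i.val = k := ⟨⟨k, hk⟩, rfl⟩
    rw [zPoly_succ, ofPoly_X, z_eq_zNat]

theorem y_mul_ofPoly (j : Fin n) (p : MvPolynomial (Fin n) K) :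
    y q γ j * ofPoly hγ p = ofPoly hγ ((crossedData q γ).act (Pi.single j 1) p) * y q γ j := by
  induction p using MvPolynomial.induction_on with
  | C k =>
    rw [MvPolynomial.algHom_C, ← MvPolynomial.algebraMap_eq, AlgHom.commutes, AlgHom.commutes,
      Algebra.commutes]
  | add p r hp hr => rw [map_add, map_add, mul_add, hp, hr, map_add, add_mul]
  | mul_X p i hp =>
    rw [map_mul, ← mul_assoc, hp, map_mul, map_mul, mul_assoc, mul_assoc, ofPoly_X, act_X,
      map_smul, ofPoly_X, z_eq_zNat, y_mul_zNat j i.isLt, smul_mul_assoc]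

theorem ofPoly_mul_x (j : Fin n) (p : MvPolynomial (Fin n) K) :
    ofPoly hγ p * x q γ j = x q γ j * ofPoly hγ ((crossedData q γ).act (Pi.single j 1) p) := by
  induction p using MvPolynomial.induction_on with
  | C k =>
    rw [MvPolynomial.algHom_C, ← MvPolynomial.algebraMap_eq, AlgHom.commutes, AlgHom.commutes,
      Algebra.commutes]
  | add p r hp hr => rw [map_add, map_add, add_mul, hp, hr, map_add, mul_add]
  | mul_X p i hp =>
    rw [map_mul, mul_assoc, ofPoly_X, z_eq_zNat, zNat_mul_x hγ j i.isLt, mul_smul_comm, ← mul_assoc,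
      hp, map_mul, act_X, map_mul, map_smul, ofPoly_X, mul_smul_comm, mul_smul_comm, z_eq_zNat,
      mul_assoc]

variable (hγ) in
theorem x_mul_ofPoly (j : Fin n) (p : MvPolynomial (Fin n) K) :
    x q γ j * ofPoly hγ p = ofPoly hγ ((crossedData q γ).act (-Pi.single j 1) p) * x q γ j := by
  rw [ofPoly_mul_x, CrossedData.act_act_neg]

variable (q γ) in
/-- The power `yᵢ ^ k` if `k ≥ 0`, and `xᵢ ^ (-k)` if `k ≤ 0`. -/
noncomputable def signedPow (i : Fin n) : ℤ → QWeylAlgebra q γ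
  | .ofNat m => y q γ i ^ m
  | .negSucc m => x q γ i ^ (m + 1)

theorem signedPow_natCast (i : Fin n) (m : ℕ) : signedPow q γ i m = y q γ i ^ m := rfl

theorem signedPow_neg_natCast (i : Fin n) (m : ℕ) : signedPow q γ i (-m) = x q γ i ^ m := by
  cases m with
  | zero => simpa using signedPow_natCast (q := q) (γ := γ) i 0
  | succ m => rfl

theorem signedPow_induction {p : QWeylAlgebra q γ → Prop} (i : Fin n) (k : ℤ) (hx : p (x q γ i))
    (hy : p (y q γ i)) (one : p 1) (mul : ∀ a b, p a → p b → p (a * b)) :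
    p (signedPow q γ i k) := by
  have pow : ∀ a, p a → ∀ m : ℕ, p (a ^ m) := fun a ha m ↦ by
    induction m with
    | zero => rwa [pow_zero]
    | succ m ih => rw [pow_succ]; exact mul _ _ ih ha
  cases k with
  | ofNat m => exact pow _ hy m
  | negSucc m => exact pow _ hx (m + 1)

variable (hγ) in
-- Consecutive `z`'s differ by `(q_i - 1) y_i x_i`, and `q_i - 1` is invertible.
theorem exists_yx_eq_ofPoly (hq : ∀ i, q i ≠ 1) (i : Fin n) :
    ∃ p, y q γ i * x q γ i = ofPoly hγ p := by
  have h := zNat_succ (q := q) (γ := γ) i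
  have hq' : (q i - 1 : K) ≠ 0 := sub_ne_zero.2 (by simpa using hq i)
  rw [← sub_eq_iff_eq_add', ← inv_smul_eq_iff₀ hq'] at h
  refine ⟨(q i - 1 : K)⁻¹ • (zPoly K n (i.val + 1) - zPoly K n i), ?_⟩
  rw [map_smul, map_sub, ofPoly_zPoly i.isLt, ofPoly_zPoly i.isLt.le, h]

variable (hγ) in
-- For `k < 0` the new `y_i` meets an `x_i`, and `y_i x_i` is absorbed into the polynomial; for `k ≥
-- 0` nothing needs rewriting.
theorem exists_y_mul_signedPow (hq : ∀ i, q i ≠ 1) (i : Fin n) (k : ℤ) :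
    ∃ p, y q γ i * signedPow q γ i k = ofPoly hγ p * signedPow q γ i (k + 1) := by
  obtain ⟨m, rfl | rfl⟩ := k.eq_nat_or_neg
  · refine ⟨1, ?_⟩
    rw [signedPow_natCast, map_one, one_mul, ← pow_succ', ← signedPow_natCast, Nat.cast_succ]
  · cases m with
    | zero =>
      refine ⟨1, ?_⟩
      rw [signedPow_neg_natCast, map_one, one_mul, pow_zero, mul_one]
      simpa using (signedPow_natCast (q := q) (γ := γ) i 1).symm
    | succ m =>
      obtain ⟨p, hp⟩ := exists_yx_eq_ofPoly hγ hq i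
      refine ⟨p, ?_⟩
      rw [signedPow_neg_natCast, pow_succ', ← mul_assoc, hp, ← signedPow_neg_natCast]
      congr 2
      push_cast
      ring

variable (hγ) in
theorem exists_x_mul_signedPow (hq : ∀ i, q i ≠ 1) (i : Fin n) (k : ℤ) :
    ∃ p, x q γ i * signedPow q γ i k = ofPoly hγ p * signedPow q γ i (k + -1) := by
  obtain ⟨m, rfl | rfl⟩ := k.eq_nat_or_neg
  · cases m with
    | zero =>
      refine ⟨1, ?_⟩
      rw [signedPow_natCast, map_one, one_mul, pow_zero, mul_one]
      simpa using (signedPow_neg_natCast (q := q) (γ := γ) i 1).symm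
    | succ m =>
      obtain ⟨p, hp⟩ := exists_yx_eq_ofPoly hγ hq i
      refine ⟨(q i : K) • p + zPoly K n i, ?_⟩
      rw [signedPow_natCast, pow_succ', ← mul_assoc, x_mul_y_self, hp, ← signedPow_natCast, map_add,
        map_smul, ofPoly_zPoly i.isLt.le]
      congr 2
      push_cast
      ring
  · refine ⟨1, ?_⟩
    rw [signedPow_neg_natCast, map_one, one_mul, ← pow_succ', ← signedPow_neg_natCast,
      Nat.cast_succ, neg_add]

variable (q γ) in
/-- The ordered product of `signedPow i (d i)` over the indices `i < k`. -/
noncomputable def partialWord (d : Fin n → ℤ) : ℕ → QWeylAlgebra q γ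
  | 0 => 1
  | k + 1 => partialWord d k * if h : k < n then signedPow q γ ⟨k, h⟩ (d ⟨k, h⟩) else 1

theorem partialWord_zero (d : Fin n → ℤ) : partialWord q γ d 0 = 1 := rfl

theorem partialWord_succ (d : Fin n → ℤ) (i : Fin n) :
    partialWord q γ d (i.val + 1) = partialWord q γ d i * signedPow q γ i (d i) := by
  rw [partialWord, dif_pos i.isLt]

theorem partialWord_congr {d e : Fin n → ℤ} {k : ℕ} (h : ∀ i : Fin n, i.val < k → d i = e i) :
    partialWord q γ d k = partialWord q γ e k := by
  induction k with
  | zero => rfl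
  | succ k ih =>
    rw [partialWord, partialWord, ih fun i hi ↦ h i (by omega)]
    congr 1
    split_ifs with hk
    · rw [h ⟨k, hk⟩ (Nat.lt_succ_self k)]
    · rfl

theorem partialWord_induction {p : QWeylAlgebra q γ → Prop} (d : Fin n → ℤ) (k : ℕ)
    (hx : ∀ i : Fin n, i.val < k → p (x q γ i)) (hy : ∀ i : Fin n, i.val < k → p (y q γ i))
    (one : p 1) (mul : ∀ a b, p a → p b → p (a * b)) : p (partialWord q γ d k) := by
  induction k with
  | zero => exact one
  | succ k ih =>
    refine mul _ _ (ih (fun i hi ↦ hx i (by omega)) fun i hi ↦ hy i (by omega)) ?_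
    split_ifs with hk
    · exact signedPow_induction _ _ (hx ⟨k, hk⟩ (Nat.lt_succ_self k))
        (hy ⟨k, hk⟩ (Nat.lt_succ_self k)) one mul
    · exact one

variable (hγ) in
theorem partialWord_mul_ofPoly (d : Fin n → ℤ) (k : ℕ) (p : MvPolynomial (Fin n) K) :
    ∃ p', partialWord q γ d k * ofPoly hγ p = ofPoly hγ p' * partialWord q γ d k := by
  revert p
  refine partialWord_induction (p := fun a ↦ ∀ p, ∃ p', a * ofPoly hγ p = ofPoly hγ p' * a) d k
    (fun i _ p ↦ ⟨_, x_mul_ofPoly hγ i p⟩) (fun i _ p ↦ ⟨_, y_mul_ofPoly i p⟩)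
    (fun p ↦ ⟨p, by simp⟩) fun a b ha hb p ↦ ?_
  obtain ⟨p₁, h₁⟩ := hb p
  obtain ⟨p₂, h₂⟩ := ha p₁
  exact ⟨p₂, by rw [mul_assoc, h₁, ← mul_assoc, h₂, mul_assoc]⟩

/-- Left multiplication of an ordered product by an element of degree `δ` which commutes up to
scalars with the generators of all indices other than `i`. -/
theorem exists_mul_partialWord {t : QWeylAlgebra q γ} {i : Fin n} {δ : ℤ}
    (hx : ∀ j, j ≠ i → ∃ l : K, t * x q γ j = l • (x q γ j * t))
    (hy : ∀ j, j ≠ i → ∃ l : K, t * y q γ j = l • (y q γ j * t))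
    (ht : ∀ k, ∃ p, t * signedPow q γ i k = ofPoly hγ p * signedPow q γ i (k + δ))
    (d : Fin n → ℤ) {k : ℕ} (hk : i.val < k) (hkn : k ≤ n) :
    ∃ p, t * partialWord q γ d k = ofPoly hγ p * partialWord q γ (d + Pi.single i δ) k := by
  induction k, hk using Nat.le_induction with
  | base =>
    -- `t` moves past the letters of index below `i` at the cost of a scalar, acts on the `i`-th
    -- letter, and the polynomial produced there is carried back to the far left. Later letters are
    -- untouched.
    obtain ⟨l, hl⟩ : ∃ l : K, t * partialWord q γ d i = l • (partialWord q γ d i * t) := by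
      refine partialWord_induction (p := fun a ↦ ∃ l : K, t * a = l • (a * t)) d i
        (fun j hj ↦ hx j (Fin.ne_of_lt hj)) (fun j hj ↦ hy j (Fin.ne_of_lt hj)) ⟨1, by simp⟩ ?_
      rintro a b ⟨l, hl⟩ ⟨m, hm⟩
      refine ⟨l * m, ?_⟩
      rw [← mul_assoc, hl, smul_mul_assoc, mul_assoc, hm, mul_smul_comm, smul_smul, mul_assoc]
    obtain ⟨p, hp⟩ := ht (d i)
    obtain ⟨p', hp'⟩ := partialWord_mul_ofPoly (q := q) hγ d i p
    refine ⟨l • p', ?_⟩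
    have hcongr : partialWord q γ (d + Pi.single i δ) i = partialWord q γ d i :=
      partialWord_congr fun j hj ↦ by simp [Pi.single_eq_of_ne (Fin.ne_of_lt hj)]
    rw [Nat.succ_eq_add_one, partialWord_succ, partialWord_succ, ← mul_assoc, hl, smul_mul_assoc,
      mul_assoc, hp, ← mul_assoc, hp', hcongr, map_smul, smul_mul_assoc, mul_assoc, Pi.add_apply,
      Pi.single_eq_same]
  | succ k hk ih =>
    obtain ⟨p, hp⟩ := ih (by omega)
    obtain ⟨j, rfl⟩ : ∃ j : Fin n, j.val = k := ⟨⟨k, hkn⟩, rfl⟩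
    refine ⟨p, ?_⟩
    have hji : j ≠ i := by rintro rfl; exact absurd hk (by omega)
    rw [partialWord_succ, partialWord_succ, ← mul_assoc, hp, mul_assoc, Pi.add_apply,
      Pi.single_eq_of_ne hji, add_zero]

variable (q γ) in
/-- The ordered product of the `signedPow i (d i)`. -/
noncomputable def word (d : Fin n → ℤ) : QWeylAlgebra q γ := partialWord q γ d n

theorem word_zero : word q γ 0 = 1 := by
  suffices ∀ k, partialWord q γ 0 k = 1 from this n
  intro k
  induction k with
  | zero => rfl
  | succ k ih =>
    rw [partialWord, ih, one_mul]
    split_ifs with h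
    · exact pow_zero _
    · rfl

variable (hγ) in
theorem exists_y_mul_word (hq : ∀ i, q i ≠ 1) (i : Fin n) (d : Fin n → ℤ) :
    ∃ p, y q γ i * word q γ d = ofPoly hγ p * word q γ (d + Pi.single i 1) := by
  refine exists_mul_partialWord (fun j hj ↦ ?_) (fun j _ ↦ ⟨_, y_mul_y i j⟩)
    (exists_y_mul_signedPow hγ hq i) d i.isLt le_rfl
  exact (lt_or_gt_of_ne hj).elim (fun h ↦ ⟨_, y_mul_x_of_gt h⟩) fun h ↦ ⟨_, y_mul_x_of_lt h⟩

variable (hγ) in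
theorem exists_x_mul_word (hq : ∀ i, q i ≠ 1) (i : Fin n) (d : Fin n → ℤ) :
    ∃ p, x q γ i * word q γ d = ofPoly hγ p * word q γ (d + Pi.single i (-1)) := by
  refine exists_mul_partialWord (fun j hj ↦ ?_) (fun j hj ↦ ?_)
    (exists_x_mul_signedPow hγ hq i) d i.isLt le_rfl
  · exact (lt_or_gt_of_ne hj).elim (fun h ↦ ⟨_, x_mul_x_of_gt h⟩) fun h ↦ ⟨_, x_mul_x h⟩
  · exact (lt_or_gt_of_ne hj).elim (fun h ↦ ⟨_, x_mul_y_of_gt h⟩) fun h ↦ ⟨_, x_mul_y_of_lt h⟩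

variable (q) in
/-- The map `∑ p_d ↦ ∑ p_d(z) w_d`. -/
noncomputable def ofCoeffs (hγ : IsMulSkewSymm γ) :
    ((Fin n → ℤ) →₀ MvPolynomial (Fin n) K) →ₗ[K] QWeylAlgebra q γ :=
  Finsupp.lsum K fun d ↦ LinearMap.mulRight K (word q γ d) ∘ₗ (ofPoly hγ).toLinearMap

theorem ofCoeffs_single (d : Fin n → ℤ) (p : MvPolynomial (Fin n) K) :
    ofCoeffs q hγ (Finsupp.single d p) = ofPoly hγ p * word q γ d := by
  simp [ofCoeffs]

variable (hγ) in
theorem ofCoeffs_surjective (hq : ∀ i, q i ≠ 1) : Function.Surjective (ofCoeffs q hγ) := by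
  -- The range contains 1, so it is everything once it is stable under left multiplication; this can
  -- be checked on generators.
  suffices h : ∀ a, ∀ b ∈ LinearMap.range (ofCoeffs q hγ),
      a * b ∈ LinearMap.range (ofCoeffs q hγ) by
    intro a
    have := h a 1 ⟨Finsupp.single 0 1, by rw [ofCoeffs_single, map_one, word_zero, one_mul]⟩
    rwa [mul_one] at this
  have gen : ∀ a, (∀ p, ∃ p', a * ofPoly hγ p = ofPoly hγ p' * a) →
      (∀ d, ∃ p d', a * word q γ d = ofPoly hγ p * word q γ d') →
      ∀ b ∈ LinearMap.range (ofCoeffs q hγ), a * b ∈ LinearMap.range (ofCoeffs q hγ) := by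
    rintro a h₁ h₂ _ ⟨c, rfl⟩
    induction c using Finsupp.induction_linear with
    | zero => simp
    | add c c' hc hc' => rw [map_add, mul_add]; exact add_mem hc hc'
    | single d p =>
      obtain ⟨p', hp'⟩ := h₁ p
      obtain ⟨r, d', hr⟩ := h₂ d
      refine ⟨Finsupp.single d' (p' * r), ?_⟩
      rw [ofCoeffs_single, ofCoeffs_single, ← mul_assoc, hp', mul_assoc, hr, map_mul, mul_assoc]
  intro a
  induction a using induction_on with
  | algebraMap k =>
    intro b hb
    rw [← Algebra.smul_def]
    exact Submodule.smul_mem _ k hb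
  | x i =>
    exact gen _ (fun p ↦ ⟨_, x_mul_ofPoly hγ i p⟩) fun d ↦
      (exists_x_mul_word hγ hq i d).imp fun p h ↦ ⟨_, h⟩
  | y i =>
    exact gen _ (fun p ↦ ⟨_, y_mul_ofPoly i p⟩) fun d ↦
      (exists_y_mul_word hγ hq i d).imp fun p h ↦ ⟨_, h⟩
  | add a a' ha ha' => intro b hb; rw [add_mul]; exact add_mem (ha b hb) (ha' b hb)
  | mul a a' ha ha' => intro b hb; rw [mul_assoc]; exact ha _ (ha' b hb)

end QWeylAlgebra

/-! ### The homomorphism to the crossed product -/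

namespace QWeyl

variable {K : Type*} [Field K] {n : ℕ} (q : Fin n → Kˣ) (γ : Fin n → Fin n → Kˣ)

/-- The polynomial representing `xⱼ yⱼ`. -/
noncomputable def xyPoly (j : Fin n) : MvPolynomial (Fin n) K :=
  (q j - 1 : K)⁻¹ • ((q j : K) • zPoly K n (j.val + 1) - zPoly K n j)

/-- The image of `yⱼ` in the crossed product. -/
noncomputable def crossedY (j : Fin n) : CrossedProduct (crossedData q γ) :=
  CrossedProduct.single (Pi.single j 1) 1

/-- The image of `xⱼ` in the crossed product. -/
noncomputable def crossedX (j : Fin n) : CrossedProduct (crossedData q γ) :=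
  CrossedProduct.single (-Pi.single j 1) (xyPoly q j)

/-- The two consecutive `z`'s in `xyPoly q i` have weights differing by the factor `q_i ^ (-d_i)`,
which is trivial here. -/
theorem act_xyPoly {i : Fin n} {d : Fin n → ℤ} (h : d i = 0) :
    (crossedData q γ).act d (xyPoly q i) = (weight q d i : K) • xyPoly q i := by
  have : weight q d (i.val + 1) = weight q d i.val := by
    rw [weight_succ, h, neg_zero, zpow_zero, one_mul]
  rw [xyPoly, map_smul, map_sub, map_smul, act_zPoly, act_zPoly, this]
  module

theorem act_xyPoly_self (j : Fin n) : (crossedData q γ).act (Pi.single j 1) (xyPoly q j) =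
    (q j - 1 : K)⁻¹ • (zPoly K n (j.val + 1) - zPoly K n j) := by
  rw [xyPoly, map_smul, map_sub, map_smul, act_zPoly, act_zPoly, weight_single, weight_single,
    if_pos (Nat.lt_succ_self _), if_neg (lt_irrefl _), smul_smul, Units.val_inv_eq_inv_val,
    mul_inv_cancel₀ (by simp), Units.val_one, one_smul, one_smul]

theorem coc_single (i j : Fin n) : (crossedData q γ).coc (Pi.single i 1) (Pi.single j 1) =
    if j < i then γ i j else 1 := cocycle_single γ i j

theorem crossedY_mul_crossedX_self (j : Fin n) : crossedY q γ j * crossedX q γ j =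
    CrossedProduct.C ((q j - 1 : K)⁻¹ • (zPoly K n (j.val + 1) - zPoly K n j)) := by
  rw [crossedY, crossedX, CrossedProduct.single_mul_single, CrossedData.coc_neg_right, coc_single,
    if_neg (lt_irrefl _), act_xyPoly_self, add_neg_cancel, inv_one, one_smul, one_mul,
    CrossedProduct.C_apply]

theorem crossedX_mul_crossedY_self (j : Fin n) : crossedX q γ j * crossedY q γ j =
    CrossedProduct.C (xyPoly q j) := by
  rw [crossedY, crossedX, CrossedProduct.single_mul_single, CrossedData.coc_neg_left, coc_single,
    if_neg (lt_irrefl _), map_one, neg_add_cancel, inv_one, one_smul, mul_one,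
    CrossedProduct.C_apply]

/-- A telescoping sum, each term being a difference of consecutive `z`'s. -/
theorem one_add_sum_crossed (hq : ∀ i, q i ≠ 1) {k : ℕ} (hk : k ≤ n) :
    1 + ∑ i ∈ Finset.univ.filter fun i : Fin n ↦ i.val < k,
      (q i - 1 : K) • (crossedY q γ i * crossedX q γ i) = CrossedProduct.C (zPoly K n k) := by
  induction k with
  | zero => simp [zPoly_zero]
  | succ k ih =>
    obtain ⟨i, rfl⟩ : ∃ i : Fin n, i.val = k := ⟨⟨k, hk⟩, rfl⟩
    have hq' : (q i - 1 : K) ≠ 0 := sub_ne_zero.2 (by simpa using hq i)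
    rw [filter_lt_succ, Finset.sum_insert (by simp), add_left_comm, ih i.isLt.le,
      crossedY_mul_crossedX_self, ← map_smul, ← map_add, smul_smul, mul_inv_cancel₀ hq', one_smul,
      sub_add_cancel]

/-- The cocycle uses only the entries of `Γ` below the diagonal; skew-symmetry recovers the full
commutation rule of the `y`'s. -/
theorem coc_mul_eq (hγ : IsMulSkewSymm γ) (i j : Fin n) :
    (crossedData q γ).coc (Pi.single i 1) (Pi.single j 1) =
      γ i j * (crossedData q γ).coc (Pi.single j 1) (Pi.single i 1) := by
  rw [coc_single, coc_single]
  rcases lt_trichotomy i j with h | rfl | h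
  · rw [if_neg h.not_gt, if_pos h, hγ.2]
  · rw [hγ.1, one_mul]
  · rw [if_neg h.not_gt, if_pos h, mul_one]

theorem crossedX_mul_crossedY {i j : Fin n} (hγ : IsMulSkewSymm γ) (hij : i ≠ j) :
    crossedX q γ i * crossedY q γ j =
      (if j < i then q j * γ j i else γ j i : K) • (crossedY q γ j * crossedX q γ i) := by
  rw [crossedX, crossedY, CrossedProduct.single_mul_single, CrossedProduct.single_mul_single,
    map_one, mul_one, one_mul, act_xyPoly q γ (by simp [Pi.single_eq_of_ne hij]), weight_single,
    CrossedData.coc_neg_left, CrossedData.coc_neg_right, coc_mul_eq q γ hγ i j, mul_inv,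
    inv_eq_of_mul_eq_one_right (hγ.2 i j), CrossedProduct.smul_single, add_comm (-_)]
  congr 1
  rw [Units.smul_def, Units.smul_def, smul_smul, smul_smul]
  congr 1
  rw [Units.val_mul]
  simp only [Fin.lt_def]
  split_ifs
  · rw [Units.val_inv_eq_inv_val (q j)]
    field_simp
  · rw [Units.val_one, mul_one]

/-- The images of the generators in the crossed product. -/
noncomputable def crossedGen : QWeylGen n → CrossedProduct (crossedData q γ)
  | .x i => crossedX q γ i
  | .y i => crossedY q γ i

theorem lift_fx (i : Fin n) :
    FreeAlgebra.lift K (crossedGen q γ) (fx K i) = crossedX q γ i :=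
  FreeAlgebra.lift_ι_apply _ _

theorem lift_fy (i : Fin n) :
    FreeAlgebra.lift K (crossedGen q γ) (fy K i) = crossedY q γ i :=
  FreeAlgebra.lift_ι_apply _ _

theorem crossed_rel (hγ : IsMulSkewSymm γ) (hq : ∀ i, q i ≠ 1) {a b : FreeAlgebra K (QWeylGen n)}
    (h : Rel q γ a b) :
    FreeAlgebra.lift K (crossedGen q γ) a = FreeAlgebra.lift K (crossedGen q γ) b := by
  cases h with
  | yy i j =>
    simp only [map_smul, map_mul, lift_fy]
    rw [crossedY, crossedY, CrossedProduct.single_mul_single, CrossedProduct.single_mul_single,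
      coc_mul_eq q γ hγ i j, CrossedProduct.smul_single, map_one, map_one, Units.smul_def,
      Units.smul_def, smul_smul, Units.val_mul, add_comm]
  | xx i j h =>
    simp only [map_smul, map_mul, lift_fx]
    rw [crossedX, crossedX, CrossedProduct.single_mul_single, CrossedProduct.single_mul_single,
      CrossedData.coc_neg_left, CrossedData.coc_neg_right, coc_mul_eq q γ hγ i j,
      CrossedProduct.smul_single, act_xyPoly q γ (by simp [Pi.single_eq_of_ne h.ne']),
      act_xyPoly q γ (by simp [Pi.single_eq_of_ne h.ne]), weight_neg, weight_neg, weight_single,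
      weight_single, if_pos (show i.val < j.val from h),
      if_neg (not_lt_of_gt (show i.val < j.val from h)), add_comm,
      CrossedData.coc_neg_left, CrossedData.coc_neg_right]
    congr 1
    simp only [inv_inv, inv_one, Units.smul_def, Units.val_one, one_smul, mul_smul_comm, smul_smul,
      Units.val_mul]
    rw [mul_comm (xyPoly q i)]
    congr 1
    ring
  | xy_lt i j h =>
    simp only [map_smul, map_mul, lift_fx, lift_fy]
    rw [crossedX_mul_crossedY q γ hγ h.ne, if_neg h.not_gt]
  | xy_gt i j h =>
    simp only [map_smul, map_mul, lift_fx, lift_fy]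
    rw [crossedX_mul_crossedY q γ hγ h.ne', if_pos h]
  | xy_diag j =>
    simp only [map_smul, map_mul, map_sub, map_add, map_one, map_sum, lift_fx, lift_fy]
    have hIio : Finset.Iio j = Finset.univ.filter fun i : Fin n ↦ i.val < j.val := by
      ext i
      rw [Finset.mem_Iio, Finset.mem_filter, Fin.lt_def]
      exact ⟨fun h ↦ ⟨Finset.mem_univ i, h⟩, fun h ↦ h.2⟩
    have hq' : (q j - 1 : K) ≠ 0 := sub_ne_zero.2 (by simpa using hq j)
    rw [hIio, one_add_sum_crossed q γ hq j.isLt.le, crossedY_mul_crossedX_self,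
      crossedX_mul_crossedY_self, ← map_smul, ← map_sub, xyPoly, smul_comm (q j : K), ← smul_sub]
    congr 1
    rw [inv_smul_eq_iff₀ hq']
    module

end QWeyl

/-! ### Injectivity and divisibility by the `z`'s -/

namespace QWeylAlgebra

open QWeyl

variable {K : Type*} [Field K] {n : ℕ} {q : Fin n → Kˣ} {γ : Fin n → Fin n → Kˣ}

/-- The embedding of the quantized Weyl algebra into its localization at the `yᵢ`. -/
noncomputable def toCrossed (hγ : IsMulSkewSymm γ) (hq : ∀ i, q i ≠ 1) :
    QWeylAlgebra q γ →ₐ[K] CrossedProduct (crossedData q γ) :=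
  RingQuot.liftAlgHom K ⟨FreeAlgebra.lift K (crossedGen q γ),
    fun _ _ h ↦ crossed_rel q γ hγ hq h⟩

variable {hγ : IsMulSkewSymm γ} {hq : ∀ i, q i ≠ 1}

theorem toCrossed_mk (a : FreeAlgebra K (QWeylGen n)) : toCrossed hγ hq (mk q γ a) =
    FreeAlgebra.lift K (crossedGen q γ) a :=
  RingQuot.liftAlgHom_mkAlgHom_apply _ _ _ _

theorem toCrossed_x (i : Fin n) : toCrossed hγ hq (x q γ i) = crossedX q γ i := by
  rw [x, toCrossed_mk, lift_fx]

theorem toCrossed_y (i : Fin n) : toCrossed hγ hq (y q γ i) = crossedY q γ i := by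
  rw [y, toCrossed_mk, lift_fy]

theorem toCrossed_z (i : Fin n) :
    toCrossed hγ hq (z q γ i) = CrossedProduct.C (MvPolynomial.X i) := by
  rw [z_eq_zNat, zNat, ← zPoly_succ, ← one_add_sum_crossed q γ hq i.isLt]
  simp only [map_add, map_one, map_sum, map_smul, map_mul, toCrossed_x, toCrossed_y]

theorem toCrossed_ofPoly (p : MvPolynomial (Fin n) K) :
    toCrossed hγ hq (ofPoly hγ p) = CrossedProduct.C p := by
  rw [← AlgHom.comp_apply]
  congr 1
  ext i
  rw [AlgHom.comp_apply, ofPoly_X, toCrossed_z]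

/-- A homogeneous element of the crossed product whose coefficient is divisible by none of the
variables. -/
def IsPrimitiveOfDegree (d : Fin n → ℤ) (s : CrossedProduct (crossedData q γ)) : Prop :=
  ∃ p ≠ 0, (∀ l, ¬ MvPolynomial.X l ∣ p) ∧ s = CrossedProduct.single d p

theorem X_dvd_act {l : Fin n} (d : Fin n → ℤ) (p : MvPolynomial (Fin n) K)
    (h : MvPolynomial.X l ∣ p) : MvPolynomial.X l ∣ (crossedData q γ).act d p := by
  obtain ⟨r, rfl⟩ := h
  rw [map_mul, act_X, smul_mul_assoc]
  exact dvd_smul_of_dvd _ (dvd_mul_right _ _)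

/-- A form of Gauss's lemma: each variable is prime, and the action only rescales it. -/
theorem IsPrimitiveOfDegree.mul {d e : Fin n → ℤ} {s t : CrossedProduct (crossedData q γ)}
    (hs : IsPrimitiveOfDegree d s) (ht : IsPrimitiveOfDegree e t) :
    IsPrimitiveOfDegree (d + e) (s * t) := by
  obtain ⟨p, hp0, hp, rfl⟩ := hs
  obtain ⟨r, hr0, hr, rfl⟩ := ht
  refine ⟨_, ?_, fun l h ↦ ?_, CrossedProduct.single_mul_single _ _ _ _⟩
  · rw [Units.smul_def, smul_ne_zero_iff]
    refine ⟨by simp, mul_ne_zero hp0 ?_⟩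
    rwa [Ne, map_eq_zero_iff _ (CrossedData.act_injective _ d)]
  · rw [Units.smul_def] at h
    have h' := dvd_smul_of_dvd (((crossedData q γ).coc d e)⁻¹ : Kˣ).val h
    rw [smul_smul, ← Units.val_mul, inv_mul_cancel, Units.val_one, one_smul] at h'
    obtain h1 | h1 := MvPolynomial.X_prime.dvd_or_dvd h'
    · exact hp l h1
    · have := X_dvd_act (q := q) (γ := γ) (-d) _ h1
      rw [CrossedData.act_neg_act] at this
      exact hr l this

theorem isPrimitiveOfDegree_one :
    IsPrimitiveOfDegree 0 (1 : CrossedProduct (crossedData q γ)) :=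
  ⟨1, one_ne_zero, fun _ h ↦ MvPolynomial.X_prime.not_isUnit (isUnit_of_dvd_one h), rfl⟩

theorem IsPrimitiveOfDegree.pow {d : Fin n → ℤ} {s : CrossedProduct (crossedData q γ)}
    (hs : IsPrimitiveOfDegree d s) (m : ℕ) : IsPrimitiveOfDegree ((m : ℤ) • d) (s ^ m) := by
  induction m with
  | zero => simpa using isPrimitiveOfDegree_one
  | succ m ih =>
    rw [pow_succ]
    convert ih.mul hs using 1
    push_cast
    rw [add_smul, one_smul]

theorem isPrimitiveOfDegree_crossedY (i : Fin n) :
    IsPrimitiveOfDegree (Pi.single i 1) (crossedY q γ i) :=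
  ⟨1, one_ne_zero, fun _ h ↦ MvPolynomial.X_prime.not_isUnit (isUnit_of_dvd_one h), rfl⟩

/-- Such a point rules out divisibility by the variable of index `l`. Up to a scalar the polynomial
is `q_i` times one `z` minus its predecessor: for the first index the predecessor is 1 and the
origin works; otherwise one of the two coordinates involved is different from `l`, and its unit
vector works. -/
theorem eval_ne_zero_of_xyPoly (hq : ∀ i, q i ≠ 1) (i l : Fin n) :
    ∃ v : Fin n → K, v l = 0 ∧ MvPolynomial.eval v (xyPoly q i) ≠ 0 := by
  have hq' : (q i - 1 : K) ≠ 0 := sub_ne_zero.2 (by simpa using hq i)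
  obtain hi | ⟨j, hj⟩ : i.val = 0 ∨ ∃ j : Fin n, i.val = j.val + 1 := by
    rcases h : i.val with _ | m
    · exact .inl rfl
    · exact .inr ⟨⟨m, by omega⟩, rfl⟩
  · refine ⟨0, rfl, ?_⟩
    rw [xyPoly, zPoly_succ, hi, zPoly_zero]
    simpa [MvPolynomial.smul_eval] using hq'
  · have hji : j ≠ i := by rintro rfl; omega
    rw [xyPoly, zPoly_succ, hj, zPoly_succ]
    by_cases hl : l = i
    · refine ⟨Pi.single j 1, by simp [hl, hji.symm], ?_⟩
      simpa [MvPolynomial.smul_eval, hji.symm] using hq'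
    · refine ⟨Pi.single i 1, by simp [hl], ?_⟩
      simpa [MvPolynomial.smul_eval, hji] using hq'

theorem isPrimitiveOfDegree_crossedX (hq : ∀ i, q i ≠ 1) (i : Fin n) :
    IsPrimitiveOfDegree (-Pi.single i 1) (crossedX q γ i) := by
  refine ⟨xyPoly q i, ?_, fun l h ↦ ?_, rfl⟩
  · obtain ⟨v, -, hv⟩ := eval_ne_zero_of_xyPoly hq i i
    rintro h
    exact hv (by rw [h, map_zero])
  · obtain ⟨v, hl, hv⟩ := eval_ne_zero_of_xyPoly hq i l
    obtain ⟨r, hr⟩ := h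
    exact hv (by rw [hr, map_mul, MvPolynomial.eval_X, hl, zero_mul])

theorem isPrimitiveOfDegree_signedPow (i : Fin n) (k : ℤ) :
    IsPrimitiveOfDegree (Pi.single i k) (toCrossed hγ hq (signedPow q γ i k)) := by
  obtain ⟨m, rfl | rfl⟩ := k.eq_nat_or_neg
  · rw [signedPow_natCast, map_pow, toCrossed_y]
    convert (isPrimitiveOfDegree_crossedY i).pow m using 1
    rw [← Pi.single_smul, smul_eq_mul, mul_one]
  · rw [signedPow_neg_natCast, map_pow, toCrossed_x]
    convert (isPrimitiveOfDegree_crossedX hq i).pow m using 1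
    rw [smul_neg, ← Pi.single_smul, smul_eq_mul, mul_one, Pi.single_neg]

theorem isPrimitiveOfDegree_partialWord (d : Fin n → ℤ) {k : ℕ} (hk : k ≤ n) :
    IsPrimitiveOfDegree (fun i ↦ if i.val < k then d i else 0)
      (toCrossed hγ hq (partialWord q γ d k)) := by
  induction k with
  | zero =>
    rw [partialWord_zero, map_one]
    convert isPrimitiveOfDegree_one using 1
    ext i
    simp
  | succ k ih =>
    obtain ⟨i, rfl⟩ : ∃ i : Fin n, i.val = k := ⟨⟨k, hk⟩, rfl⟩
    rw [partialWord_succ, map_mul]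
    convert (ih i.isLt.le).mul (isPrimitiveOfDegree_signedPow i (d i)) using 1
    ext j
    rw [Pi.add_apply, Pi.single_apply]
    by_cases hj : j = i
    · subst hj
      simp
    · have := Fin.val_ne_of_ne hj
      rw [if_neg hj, add_zero]
      congr 1
      exact propext (by omega)

theorem isPrimitiveOfDegree_word (d : Fin n → ℤ) :
    IsPrimitiveOfDegree d (toCrossed hγ hq (word q γ d)) := by
  have h := isPrimitiveOfDegree_partialWord (hγ := hγ) (hq := hq) d le_rfl
  simp only [Fin.is_lt, if_true] at h
  exact h

/-- Words of different degrees land in different components, so the composite is diagonal: each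
coefficient can be read off separately, up to the factor `p`. -/
theorem coeff_toCrossed_ofCoeffs {d : Fin n → ℤ} {p : MvPolynomial (Fin n) K}
    (hp : toCrossed hγ hq (word q γ d) = CrossedProduct.single d p)
    (c : (Fin n → ℤ) →₀ MvPolynomial (Fin n) K) :
    CrossedProduct.coeff (toCrossed hγ hq (ofCoeffs q hγ c)) d = c d * p := by
  induction c using Finsupp.induction_linear with
  | zero => simp
  | add c c' hc hc' => simp only [map_add, Finsupp.add_apply, hc, hc', add_mul]
  | single e r =>
    obtain ⟨p', -, -, hp'⟩ := isPrimitiveOfDegree_word (hγ := hγ) (hq := hq) e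
    rw [ofCoeffs_single, map_mul, toCrossed_ofPoly, hp', CrossedProduct.C_mul_single,
      CrossedProduct.coeff_single]
    by_cases h : e = d
    · subst h
      rw [hp'] at hp
      have : p' = p := Finsupp.single_injective _ hp
      rw [Finsupp.single_eq_same, Finsupp.single_eq_same, this]
    · rw [Finsupp.single_eq_of_ne' h, Finsupp.single_eq_of_ne' h, zero_mul]

variable (hγ hq) in
theorem toCrossed_injective : Function.Injective (toCrossed hγ hq) := by
  rw [injective_iff_map_eq_zero]
  intro a ha
  obtain ⟨c, rfl⟩ := ofCoeffs_surjective hγ hq a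
  suffices c = 0 by rw [this, map_zero]
  ext1 d
  obtain ⟨p, hp0, -, hp⟩ := isPrimitiveOfDegree_word (hγ := hγ) (hq := hq) d
  have := coeff_toCrossed_ofCoeffs hp c
  rw [ha, map_zero, Finsupp.zero_apply, eq_comm, mul_eq_zero] at this
  exact this.resolve_right hp0

/-- The elements of the quantized Weyl algebra that become divisible by `zᵢ` in the localization
are divisible by `zᵢ`. -/
theorem exists_eq_z_mul {i : Fin n} {a : QWeylAlgebra q γ}
    (h : ∀ d, MvPolynomial.X i ∣ CrossedProduct.coeff (toCrossed hγ hq a) d) :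
    ∃ b, a = z q γ i * b := by
  obtain ⟨c, rfl⟩ := ofCoeffs_surjective hγ hq a
  have hc : ∀ d, ∃ r, c d = MvPolynomial.X i * r := by
    intro d
    obtain ⟨p, -, hp0, hp⟩ := isPrimitiveOfDegree_word (hγ := hγ) (hq := hq) d
    have := h d
    rw [coeff_toCrossed_ofCoeffs hp c] at this
    exact (MvPolynomial.X_prime.dvd_or_dvd this).resolve_right (hp0 i)
  choose r hr using hc
  refine ⟨∑ d ∈ c.support, ofPoly hγ (r d) * word q γ d, ?_⟩
  conv_lhs => rw [← Finsupp.sum_single c, Finsupp.sum, map_sum]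
  rw [Finset.mul_sum]
  refine Finset.sum_congr rfl fun d _ ↦ ?_
  rw [ofCoeffs_single, hr, map_mul, ofPoly_X, mul_assoc]

end QWeylAlgebra

/-! ### Prime ideals, normal elements and height one -/

namespace TwoSidedIdeal

variable {R : Type*} [Ring R]

/-- A completely prime ideal is prime. -/
theorem isPrimeIdeal_of_mul_mem {P : TwoSidedIdeal R} (hP : P ≠ ⊤)
    (h : ∀ a b, a * b ∈ P → a ∈ P ∨ b ∈ P) : P.IsPrimeIdeal := by
  refine ⟨hP, fun I J hIJ ↦ ?_⟩
  by_contra! hc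
  obtain ⟨a, ha, haP⟩ := SetLike.not_le_iff_exists.1 hc.1
  obtain ⟨b, hb, hbP⟩ := SetLike.not_le_iff_exists.1 hc.2
  exact (h a b (hIJ a ha b hb)).elim haP hbP

theorem one_notMem {P : TwoSidedIdeal R} (hP : P ≠ ⊤) : (1 : R) ∉ P := fun h ↦
  hP (eq_top_iff.2 fun a _ ↦ by simpa using P.mul_mem_left a 1 h)

/-- A normal element outside a prime ideal is regular modulo this ideal. -/
theorem IsPrimeIdeal.mem_of_mul_mem {P : TwoSidedIdeal R} (hP : P.IsPrimeIdeal) {z : R}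
    (hz : ∀ r, ∃ r', r * z = z * r') (hzP : z ∉ P) {a : R} (ha : a * z ∈ P) : a ∈ P := by
  -- Normality of `z` makes this left annihilator modulo `P` closed under right multiplication. Its
  -- right annihilator `J` modulo `P` contains `z`, so primeness of `P` applied to `I` and `J`
  -- leaves only `I ≤ P`.
  let I : TwoSidedIdeal R := .mk' {b | b * z ∈ P} (by simp [P.zero_mem])
    (fun {b c} hb hc ↦ by
      rw [Set.mem_ofPred_eq, add_mul]
      exact P.add_mem hb hc)
    (fun {b} hb ↦ by
      rw [Set.mem_ofPred_eq, neg_mul]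
      exact P.neg_mem hb)
    (fun {b c} hc ↦ by
      rw [Set.mem_ofPred_eq, mul_assoc]
      exact P.mul_mem_left _ _ hc)
    (fun {b c} hb ↦ by
      obtain ⟨r, hr⟩ := hz c
      rw [Set.mem_ofPred_eq, mul_assoc, hr, ← mul_assoc]
      exact P.mul_mem_right _ _ hb)
  have hI : ∀ b, b ∈ I ↔ b * z ∈ P := fun b ↦ mem_mk' _ _ _ _ _ _ _
  let J : TwoSidedIdeal R := .mk' {c | ∀ b ∈ I, b * c ∈ P} (fun b _ ↦ by simp [P.zero_mem])
    (fun {c d} hc hd b hb ↦ by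
      rw [mul_add]
      exact P.add_mem (hc b hb) (hd b hb))
    (fun {c} hc b hb ↦ by
      rw [mul_neg]
      exact P.neg_mem (hc b hb))
    (fun {c d} hd b hb ↦ by
      rw [← mul_assoc]
      exact hd _ (I.mul_mem_right _ _ hb))
    (fun {c d} hc b hb ↦ by
      rw [← mul_assoc]
      exact P.mul_mem_right _ _ (hc b hb))
  have hJ : ∀ c, c ∈ J ↔ ∀ b ∈ I, b * c ∈ P := fun c ↦ mem_mk' _ _ _ _ _ _ _
  obtain h | h := hP.2 I J fun b hb c hc ↦ (hJ c).1 hc b hb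
  · exact h ((hI a).2 ha)
  · exact absurd (h ((hJ z).2 fun b hb ↦ (hI b).1 hb)) hzP

theorem smul_mem_of_mem {K : Type*} [Field K] [Algebra K R] (P : TwoSidedIdeal R) (k : K) {a : R}
    (ha : a ∈ P) : k • a ∈ P := by
  rw [Algebra.smul_def]
  exact P.mul_mem_left _ _ ha

theorem mem_of_smul_mem {K : Type*} [Field K] [Algebra K R] (P : TwoSidedIdeal R) {k : K}
    (hk : k ≠ 0) {a : R} (ha : k • a ∈ P) : a ∈ P := by
  simpa [smul_smul, inv_mul_cancel₀ hk] using P.smul_mem_of_mem k⁻¹ ha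

/-- If the zero ideal is prime, every nonzero prime ideal contains a member of a given family of
pairwise incomparable nonzero prime ideals, then this family consists of the primes of
height one. -/
theorem setOf_isHeightOnePrime_eq_range {ι : Type*} (Z : ι → TwoSidedIdeal R)
    (hbot : (⊥ : TwoSidedIdeal R).IsPrimeIdeal) (hZ : ∀ i, (Z i).IsPrimeIdeal)
    (hZ0 : ∀ i, Z i ≠ ⊥) (hinc : ∀ i j, Z i ≤ Z j → i = j)
    (hex : ∀ P : TwoSidedIdeal R, P.IsPrimeIdeal → P ≠ ⊥ → ∃ i, Z i ≤ P) :
    {P : TwoSidedIdeal R | P.IsHeightOnePrime} = Set.range Z := by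
  have hmin : ∀ P : {I : TwoSidedIdeal R // I.IsPrimeIdeal}, IsMin P ↔ P.1 = ⊥ := fun P ↦
    ⟨fun h ↦ le_bot_iff.1 (h (b := ⟨⊥, hbot⟩) (show (⊥ : TwoSidedIdeal R) ≤ P.1 from bot_le)),
      fun h Q _ ↦ by
      change P.1 ≤ Q.1
      exact h ▸ bot_le⟩
  have hone : ∀ P : {I : TwoSidedIdeal R // I.IsPrimeIdeal},
      Order.height P = 1 ↔ P.1 ≠ ⊥ ∧ ∀ Q < P, Q.1 = ⊥ := by
    intro P
    have hle : Order.height P ≤ 1 ↔ ∀ Q < P, Q.1 = ⊥ := by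
      rw [← Nat.cast_one, Order.height_le_coe_iff]
      refine forall₂_congr fun Q _ ↦ ?_
      rw [Nat.cast_one, Order.lt_one_iff, Order.height_eq_zero, hmin]
    rw [← hle, Ne, ← hmin, ← Order.height_ne_zero, ← Order.one_le_iff_ne_zero, le_antisymm_iff,
      and_comm]
  ext P
  constructor
  · rintro ⟨hP, h⟩
    rw [hone] at h
    obtain ⟨i, hi⟩ := hex P hP h.1
    refine ⟨i, hi.eq_of_not_lt fun hlt ↦ hZ0 i (h.2 ⟨Z i, hZ i⟩ hlt)⟩
  · rintro ⟨i, rfl⟩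
    refine ⟨hZ i, (hone _).2 ⟨hZ0 i, fun Q hQ ↦ ?_⟩⟩
    by_contra hQ0
    obtain ⟨j, hj⟩ := hex Q.1 Q.2 hQ0
    have hji : j = i := hinc j i (hj.trans hQ.le)
    subst hji
    exact not_le_of_gt hQ hj

end TwoSidedIdeal

/-! ### Eigenvalues of the action on monomials, and how they separate -/

namespace QWeyl

variable {K : Type*} [Field K] {n : ℕ} (q : Fin n → Kˣ) (γ : Fin n → Fin n → Kˣ)

/-- The eigenvalue of the monomial with exponent `m` under the action of degree `d`. -/
noncomputable def monomialWeight (d : Fin n → ℤ) (m : Fin n →₀ ℕ) : K :=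
  ∏ i, (weight q d (i.val + 1) : K) ^ m i

theorem coeff_act (d : Fin n → ℤ) (m : Fin n →₀ ℕ) (c : MvPolynomial (Fin n) K) :
    ((crossedData q γ).act d c).coeff m = monomialWeight q d m * c.coeff m := by
  induction c using MvPolynomial.induction_on' with
  | monomial u a =>
    have : (crossedData q γ).act d (MvPolynomial.monomial u a) =
        monomialWeight q d u • MvPolynomial.monomial u a := by
      rw [MvPolynomial.monomial_eq, map_mul, Finsupp.prod_fintype _ _ (by simp), map_prod,
        MvPolynomial.algHom_C, MvPolynomial.algebraMap_eq, monomialWeight]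
      simp only [map_pow, act_X, smul_pow]
      rw [← mul_smul_comm]
      congr 1
      simp only [MvPolynomial.smul_eq_C_mul, Finset.prod_mul_distrib, map_prod]
    rw [this, MvPolynomial.coeff_smul, smul_eq_mul, MvPolynomial.coeff_monomial]
    split_ifs with h
    · rw [h]
    · simp
  | add c c' hc hc' => rw [map_add, MvPolynomial.coeff_add, MvPolynomial.coeff_add, hc, hc',
      mul_add]

variable {q}

theorem not_isOfFinOrder (hq : ∀ i, ∀ m : ℕ, 0 < m → q i ^ m ≠ 1) (i : Fin n) :
    ¬ IsOfFinOrder (q i) := by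
  rw [isOfFinOrder_iff_pow_eq_one]
  rintro ⟨m, hm, h⟩
  exact hq i m hm h

/-- The ratio of consecutive weights is `q_i ^ (-d_i)`, which determines `d_i` because `q_i` has
infinite order. -/
theorem eq_of_weight_eq (hq : ∀ i, ∀ m : ℕ, 0 < m → q i ^ m ≠ 1) {d e : Fin n → ℤ}
    (h : ∀ i : Fin n, weight q d (i.val + 1) = weight q e (i.val + 1)) : d = e := by
  ext i
  have hi : weight q d i.val = weight q e i.val := by
    rcases hm : i.val with _ | m
    · rw [weight_zero_right, weight_zero_right]
    · exact h ⟨m, by omega⟩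
  have := h i
  rw [weight_succ, weight_succ, hi, mul_left_inj] at this
  exact neg_injective (injective_zpow_iff_not_isOfFinOrder.2 (not_isOfFinOrder hq i) this)

theorem monomialWeight_single (j : Fin n) (m : Fin n →₀ ℕ) :
    monomialWeight q (Pi.single j 1) m = (((q j)⁻¹ ^ ∑ i ∈ Finset.Ici j, m i : Kˣ) : K) := by
  rw [← Finset.prod_pow_eq_pow_sum, Units.coe_prod, monomialWeight,
    ← Finset.prod_subset (Finset.subset_univ (Finset.Ici j))]
  · refine Finset.prod_congr rfl fun i hi ↦ ?_
    rw [Finset.mem_Ici, Fin.le_def] at hi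
    rw [weight_single, if_pos (by omega), Units.val_pow_eq_pow_val]
  · intro i _ hi
    rw [Finset.mem_Ici, Fin.le_def] at hi
    rw [weight_single, if_neg (by omega), Units.val_one, one_pow]

theorem exists_monomialWeight_ne (hq : ∀ i, ∀ m : ℕ, 0 < m → q i ^ m ≠ 1) {m m' : Fin n →₀ ℕ}
    (h : m ≠ m') :
    ∃ j, monomialWeight q (Pi.single j 1) m ≠ monomialWeight q (Pi.single j 1) m' := by
  obtain ⟨i, hi⟩ := Finsupp.ne_iff.1 h
  -- `y_j` sees only the total exponent at indices `≥ j`; at the last index of disagreement, these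
  -- totals differ by exactly the difference of the `j`-th exponents.
  obtain ⟨j, hj, hmax⟩ := (Finset.univ.filter fun i ↦ m i ≠ m' i).exists_max_image id
    ⟨i, by simpa using hi⟩
  rw [Finset.mem_filter] at hj
  refine ⟨j, fun heq ↦ hj.2 ?_⟩
  rw [monomialWeight_single, monomialWeight_single, Units.val_inj] at heq
  have := injective_pow_iff_not_isOfFinOrder.2
    (fun h ↦ not_isOfFinOrder hq j (isOfFinOrder_inv_iff.1 h)) heq
  rw [← Finset.Ioi_insert, Finset.sum_insert (by simp), Finset.sum_insert (by simp),
    Finset.sum_congr rfl (g := m')] at this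
  · exact Nat.add_right_cancel this
  · intro k hk
    by_contra hne
    exact absurd (hmax k (by simpa using hne)) (not_le_of_gt (Finset.mem_Ioi.1 hk))

end QWeyl

/-! ### Primeness of `0` and of the ideals `(z_i)` -/

namespace QWeylAlgebra

open QWeyl

variable {K : Type*} [Field K] {n : ℕ} {q : Fin n → Kˣ} {γ : Fin n → Fin n → Kˣ}

theorem exists_mul_z_eq (hγ : IsMulSkewSymm γ) (i : Fin n) (r : QWeylAlgebra q γ) :
    ∃ r', r * z q γ i = z q γ i * r' := by
  rw [z_eq_zNat]
  induction r using induction_on with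
  | algebraMap k => exact ⟨_, Algebra.commutes _ _⟩
  | y j => exact ⟨_, by rw [y_mul_zNat j i.isLt, ← mul_smul_comm]⟩
  | x j =>
    refine ⟨(weight q (Pi.single j 1) (i.val + 1) : K)⁻¹ • x q γ j, ?_⟩
    rw [mul_smul_comm, zNat_mul_x hγ j i.isLt, smul_smul, inv_mul_cancel₀ (by simp), one_smul]
  | add a b ha hb =>
    obtain ⟨a', ha⟩ := ha
    obtain ⟨b', hb⟩ := hb
    exact ⟨a' + b', by rw [add_mul, ha, hb, mul_add]⟩
  | mul a b ha hb =>
    obtain ⟨a', ha⟩ := ha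
    obtain ⟨b', hb⟩ := hb
    exact ⟨a' * b', by rw [mul_assoc, hb, ← mul_assoc, ha, mul_assoc]⟩

theorem z_mul_y_self (i : Fin n) :
    z q γ i * y q γ i = (q i : K) • (y q γ i * z q γ i) := by
  rw [z_eq_zNat, y_mul_zNat i i.isLt, weight_single, if_pos (Nat.lt_succ_self _),
    Units.val_inv_eq_inv_val, smul_smul, mul_inv_cancel₀ (by simp), one_smul]

/-- The `q`-analogue of `[x, y ^ (m + 1)] = (m + 1) y ^ m`, used to lower powers of `y_i`. -/
theorem x_mul_y_pow_succ (i : Fin n) (m : ℕ) : x q γ i * y q γ i ^ (m + 1) =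
    y q γ i ^ (m + 1) * x q γ i +
      (∑ k ∈ Finset.range (m + 1), (q i : K) ^ k) • (y q γ i ^ m * z q γ i) := by
  have h : x q γ i * y q γ i = y q γ i * x q γ i + z q γ i := by rw [z_eq_commutator]; abel
  induction m with
  | zero => simpa using h
  | succ m ih =>
    rw [pow_succ (y q γ i) (m + 1), ← mul_assoc, ih, add_mul, mul_assoc (_ ^ (m + 1)), h,
      smul_mul_assoc, mul_assoc (_ ^ m), z_mul_y_self, mul_smul_comm, ← mul_assoc (_ ^ m),
      ← pow_succ, mul_add, ← mul_assoc, add_assoc, smul_smul, geom_sum_succ (n := m + 1), add_smul,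
      one_smul, add_comm (y q γ i ^ (m + 1) * z q γ i), mul_comm (q i : K)]

section Primes

theorem mem_span_z_iff (hγ : IsMulSkewSymm γ) (hq : ∀ i, q i ≠ 1) (i : Fin n)
    (a : QWeylAlgebra q γ) : a ∈ TwoSidedIdeal.span {z q γ i} ↔
    ∀ d, MvPolynomial.X i ∣ CrossedProduct.coeff (toCrossed hγ hq a) d := by
  constructor
  · intro h
    let P : TwoSidedIdeal (QWeylAlgebra q γ) := .mk'
      {a | ∀ d, MvPolynomial.X i ∣ CrossedProduct.coeff (toCrossed hγ hq a) d}
      (fun d ↦ by simp)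
      (fun {a b} ha hb d ↦ by
        rw [map_add, map_add, Finsupp.add_apply]
        exact dvd_add (ha d) (hb d))
      (fun {a} ha d ↦ by
        rw [map_neg, map_neg, Finsupp.neg_apply]
        exact (ha d).neg_right)
      (fun {a b} hb d ↦ by
        rw [map_mul]
        exact CrossedProduct.dvd_coeff_mul X_dvd_act (.inr hb) d)
      (fun {a b} ha d ↦ by
        rw [map_mul]
        exact CrossedProduct.dvd_coeff_mul X_dvd_act (.inl ha) d)
    have hP : TwoSidedIdeal.span {z q γ i} ≤ P := by
      rw [TwoSidedIdeal.span_le, Set.singleton_subset_iff, SetLike.mem_coe, TwoSidedIdeal.mem_mk']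
      intro d
      rw [toCrossed_z, ← mul_one (CrossedProduct.C _), CrossedProduct.coeff_C_mul]
      exact dvd_mul_right _ _
    exact (TwoSidedIdeal.mem_mk' _ _ _ _ _ _ _).1 (hP h)
  · intro h
    obtain ⟨b, rfl⟩ := exists_eq_z_mul h
    exact TwoSidedIdeal.mul_mem_right _ _ _ (TwoSidedIdeal.subset_span rfl)

theorem ofPoly_mem_span_z_iff (hγ : IsMulSkewSymm γ) (hq : ∀ i, q i ≠ 1) (i : Fin n)
    (p : MvPolynomial (Fin n) K) :
    ofPoly hγ p ∈ TwoSidedIdeal.span {z q γ i} ↔ MvPolynomial.X i ∣ p := by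
  rw [mem_span_z_iff hγ hq, toCrossed_ofPoly]
  constructor
  · intro h
    simpa [CrossedProduct.C_apply] using h 0
  · intro h d
    rw [← mul_one (CrossedProduct.C _), CrossedProduct.coeff_C_mul]
    exact h.mul_right _

theorem z_mem_span_z_iff (hγ : IsMulSkewSymm γ) (hq : ∀ i, q i ≠ 1) (i j : Fin n) :
    z q γ j ∈ TwoSidedIdeal.span {z q γ i} ↔ i = j := by
  rw [← ofPoly_X (hγ := hγ) j, ofPoly_mem_span_z_iff hγ hq, MvPolynomial.X_dvd_X]

theorem isPrimeIdeal_span_z (hγ : IsMulSkewSymm γ) (hq : ∀ i, q i ≠ 1) (i : Fin n) :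
    (TwoSidedIdeal.span {z q γ i}).IsPrimeIdeal := by
  refine TwoSidedIdeal.isPrimeIdeal_of_mul_mem (fun h ↦ ?_) fun a b hab ↦ ?_
  · have h1 : ofPoly hγ 1 ∈ TwoSidedIdeal.span {z q γ i} := by rw [h]; trivial
    rw [ofPoly_mem_span_z_iff hγ hq] at h1
    exact MvPolynomial.X_prime.not_isUnit (isUnit_of_dvd_one h1)
  · simp only [mem_span_z_iff hγ hq, map_mul] at hab ⊢
    exact CrossedProduct.dvd_coeff_or_dvd_coeff (fun _ _ ↦ MvPolynomial.X_prime.dvd_or_dvd)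
      X_dvd_act hab

theorem eq_zero_or_eq_zero_of_mul_eq_zero {S : CrossedData K (Fin n → ℤ) (MvPolynomial (Fin n) K)}
    {s t : CrossedProduct S} (h : s * t = 0) : s = 0 ∨ t = 0 := by
  -- Divisibility by `p = 0` means vanishing, so the primeness criterion specializes to the absence
  -- of zero divisors.
  have key := CrossedProduct.dvd_coeff_or_dvd_coeff (S := S) (s := s) (t := t) (p := 0)
    (by simp) (by simp +contextual) (by simp [h])
  simp only [zero_dvd_iff] at key
  refine key.imp (fun h ↦ ?_) fun h ↦ ?_
  · exact CrossedProduct.coeff.injective (by ext1 d; rw [h, map_zero, Finsupp.zero_apply])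
  · exact CrossedProduct.coeff.injective (by ext1 d; rw [h, map_zero, Finsupp.zero_apply])

theorem isPrimeIdeal_bot (hγ : IsMulSkewSymm γ) (hq : ∀ i, q i ≠ 1) :
    (⊥ : TwoSidedIdeal (QWeylAlgebra q γ)).IsPrimeIdeal := by
  have hinj := toCrossed_injective hγ hq
  refine TwoSidedIdeal.isPrimeIdeal_of_mul_mem (fun h ↦ ?_) fun a b hab ↦ ?_
  · have h1 : (1 : QWeylAlgebra q γ) ∈ (⊥ : TwoSidedIdeal (QWeylAlgebra q γ)) := by
      rw [h]; trivial
    rw [TwoSidedIdeal.mem_bot] at h1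
    have h2 : CrossedProduct.coeff (toCrossed hγ hq 1) 0 = 0 := by rw [h1]; simp
    rw [map_one, CrossedProduct.one_def, CrossedProduct.coeff_single,
      Finsupp.single_eq_same] at h2
    exact one_ne_zero h2
  · simp only [TwoSidedIdeal.mem_bot] at hab ⊢
    have := congrArg (toCrossed hγ hq) hab
    rw [map_mul, map_zero] at this
    simpa [map_eq_zero_iff _ hinj] using eq_zero_or_eq_zero_of_mul_eq_zero this

end Primes

/-! ### Nonzero ideals, and nonzero primes -/

section NonzeroIdeals

/-- Right multiplication by the word of degree `-d` brings `a` to degree 0 without killing it, and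
the degree 0 part of `A` consists of polynomials in the `z`'s. -/
theorem exists_ofPoly_mem_of_single {hγ : IsMulSkewSymm γ} {hq : ∀ i, q i ≠ 1}
    {P : TwoSidedIdeal (QWeylAlgebra q γ)} {a : QWeylAlgebra q γ} (ha : a ∈ P) {d : Fin n → ℤ}
    {p : MvPolynomial (Fin n) K} (hp : p ≠ 0)
    (had : toCrossed hγ hq a = CrossedProduct.single d p) : ∃ c ≠ 0, ofPoly hγ c ∈ P := by
  obtain ⟨r, hr0, -, hr⟩ := isPrimitiveOfDegree_word (hγ := hγ) (hq := hq) (-d)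
  obtain ⟨c, hc⟩ := ofCoeffs_surjective hγ hq (a * word q γ (-d))
  have hmul : toCrossed hγ hq (a * word q γ (-d)) ≠ 0 := by
    rw [map_mul]
    refine fun h ↦ (eq_zero_or_eq_zero_of_mul_eq_zero h).elim (fun h ↦ hp ?_) fun h ↦ hr0 ?_
    · rw [had] at h
      exact Finsupp.single_eq_zero.1 h
    · rw [hr] at h
      exact Finsupp.single_eq_zero.1 h
  have hsupp : c = Finsupp.single 0 (c 0) := by
    ext1 e
    by_cases he : e = 0
    · rw [he, Finsupp.single_eq_same]
    · obtain ⟨s, hs0, -, hs⟩ := isPrimitiveOfDegree_word (hγ := hγ) (hq := hq) e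
      have := coeff_toCrossed_ofCoeffs hs c
      rw [hc, map_mul, had, hr, CrossedProduct.single_mul_single, CrossedProduct.coeff_single,
        add_neg_cancel, Finsupp.single_eq_of_ne he, eq_comm, mul_eq_zero] at this
      rw [this.resolve_right hs0, Finsupp.single_eq_of_ne he]
  rw [hsupp, ofCoeffs_single, word_zero, mul_one] at hc
  refine ⟨c 0, fun h0 ↦ hmul ?_, hc ▸ P.mul_mem_right _ _ ha⟩
  rw [← hc, h0, map_zero, map_zero]

/-- A nonzero ideal contains a nonzero polynomial in the `zᵢ`. -/
theorem exists_ofPoly_mem (hγ : IsMulSkewSymm γ) (hq : ∀ i, ∀ m : ℕ, 0 < m → q i ^ m ≠ 1)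
    {P : TwoSidedIdeal (QWeylAlgebra q γ)} {a : QWeylAlgebra q γ} (ha : a ∈ P) (ha0 : a ≠ 0) :
    ∃ c ≠ 0, ofPoly hγ c ∈ P := by
  have hq1 : ∀ i, q i ≠ 1 := fun i ↦ by simpa using hq i 1 one_pos
  induction hN : (CrossedProduct.coeff (toCrossed hγ hq1 a)).support.card using
    Nat.strong_induction_on generalizing a with
  | _ N ih =>
  set f := CrossedProduct.coeff (toCrossed hγ hq1 a) with hf
  have hf0 : f ≠ 0 := by
    rw [hf, Ne, LinearEquiv.map_eq_zero_iff, map_eq_zero_iff _ (toCrossed_injective hγ hq1)]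
    exact ha0
  obtain ⟨d, hd⟩ := Finsupp.support_nonempty_iff.2 hf0
  by_cases hd' : ∃ e ∈ f.support, e ≠ d
  · obtain ⟨e, he, hed⟩ := hd'
    obtain ⟨i, hi⟩ : ∃ i : Fin n, weight q e (i.val + 1) ≠ weight q d (i.val + 1) := by
      by_contra! h
      exact hed (eq_of_weight_eq hq h)
    -- Chosen so that `z_i a - l a z_i` loses its component in degree `d` while keeping the one in
    -- degree `e`; no new degrees appear.
    let l : K := ((weight q d (i.val + 1))⁻¹ : Kˣ)
    have hcoeff : ∀ g, CrossedProduct.coeff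
        (toCrossed hγ hq1 (z q γ i * a - l • (a * z q γ i))) g =
        (1 - l * weight q g (i.val + 1) : K) • (MvPolynomial.X i * f g) := by
      intro g
      rw [map_sub, map_smul, map_mul, map_mul, toCrossed_z, map_sub, map_smul, Finsupp.sub_apply,
        Finsupp.smul_apply, CrossedProduct.coeff_C_mul, CrossedProduct.coeff_mul_C, act_X,
        mul_smul_comm, smul_smul, mul_comm (MvPolynomial.X i), sub_smul, one_smul]
    refine ih _ ?_ (a := z q γ i * a - l • (a * z q γ i)) (P.sub_mem (P.mul_mem_left _ _ ha)
      (P.smul_mem_of_mem l (P.mul_mem_right _ _ ha))) (fun h0 ↦ ?_) rfl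
    · rw [← hN]
      refine Finset.card_lt_card (Finset.ssubset_iff_subset_ne.2 ⟨fun g hg ↦ ?_, fun h ↦ ?_⟩)
      · rw [Finsupp.mem_support_iff] at hg ⊢
        intro h0
        exact hg (by rw [hcoeff, h0, mul_zero, smul_zero])
      · rw [← h, Finsupp.mem_support_iff, hcoeff] at hd
        refine hd ?_
        rw [← Units.val_mul, inv_mul_cancel, Units.val_one, sub_self, zero_smul]
    · have := hcoeff e
      rw [h0, map_zero, map_zero, Finsupp.zero_apply, eq_comm, smul_eq_zero, mul_eq_zero] at this
      obtain h | h | h := this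
      · rw [sub_eq_zero, ← Units.val_mul, eq_comm, Units.val_eq_one, inv_mul_eq_one] at h
        exact hi h.symm
      · exact MvPolynomial.X_ne_zero i h
      · exact Finsupp.mem_support_iff.1 he h
  · push Not at hd'
    refine exists_ofPoly_mem_of_single (hq := hq1) ha (d := d) (p := f d)
      (Finsupp.mem_support_iff.1 hd) (CrossedProduct.coeff.injective ?_)
    rw [CrossedProduct.coeff_single, ← hf]
    exact Finsupp.eq_single_iff.2 ⟨fun e he ↦ Finset.mem_singleton.2 (hd' e he), rfl⟩

variable {P : TwoSidedIdeal (QWeylAlgebra q γ)} {hγ : IsMulSkewSymm γ}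

theorem mem_of_mul_ofPoly_monomial_mem (hz : ∀ i a, a * z q γ i ∈ P → a ∈ P) (m : Fin n →₀ ℕ) :
    ∀ a, a * ofPoly hγ (MvPolynomial.monomial m 1) ∈ P → a ∈ P := by
  induction m using Finsupp.induction_linear with
  | zero => simp
  | add m m' hm hm' =>
    intro a ha
    rw [← one_mul (1 : K), ← MvPolynomial.monomial_mul, map_mul, ← mul_assoc] at ha
    exact hm _ (hm' _ ha)
  | single i k =>
    rw [← MvPolynomial.X_pow_eq_monomial]
    induction k with
    | zero => simp
    | succ k ih =>
      intro a ha
      rw [pow_succ, map_mul, ← mul_assoc, ofPoly_X] at ha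
      exact ih _ (hz i _ ha)

/-- An eigenvector `c` satisfies `c x_j = l x_j c`, so `l x_j (c y_j ^ (k + 1)) - (c y_j ^ (k + 1))
x_j` is `c [x_j, y_j ^ (k + 1)]`. This is a multiple of `c y_j ^ k z_j`, by a geometric sum that is
nonzero since `q_j ^ (k + 1) ≠ 1`; then `z_j` is cancelled. -/
theorem ofPoly_mem_of_act_eq (hq : ∀ i, ∀ m : ℕ, 0 < m → q i ^ m ≠ 1)
    (hz : ∀ i a, a * z q γ i ∈ P → a ∈ P) {c : MvPolynomial (Fin n) K} {j : Fin n} {l : K}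
    (hc : (crossedData q γ).act (Pi.single j 1) c = l • c) (k : ℕ)
    (h : ofPoly hγ c * y q γ j ^ k ∈ P) : ofPoly hγ c ∈ P := by
  induction k with
  | zero => simpa using h
  | succ k ih =>
    refine ih (hz j _ ?_)
    have hx : ofPoly hγ c * x q γ j = l • (x q γ j * ofPoly hγ c) := by
      rw [ofPoly_mul_x, hc, map_smul, mul_smul_comm]
    have hgeom : ∑ i ∈ Finset.range (k + 1), (q j : K) ^ i ≠ 0 := by
      intro h0
      have := geom_sum_mul (q j : K) (k + 1)
      rw [h0, zero_mul, eq_comm, sub_eq_zero] at this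
      exact hq j (k + 1) k.succ_pos (Units.ext (by simpa using this))
    have key := P.sub_mem (P.smul_mem_of_mem l (P.mul_mem_left (x q γ j) _ h))
      (P.mul_mem_right _ (x q γ j) h)
    rw [← mul_assoc, ← smul_mul_assoc, ← hx, mul_assoc, mul_assoc, ← mul_sub, x_mul_y_pow_succ,
      add_sub_cancel_left, mul_smul_comm, ← mul_assoc] at key
    exact P.mem_of_smul_mem hgeom key

/-- An ideal modulo which all `zᵢ` are regular contains no nonzero polynomial in the `zᵢ`. -/
theorem ofPoly_mul_y_pow_notMem (hq : ∀ i, ∀ m : ℕ, 0 < m → q i ^ m ≠ 1) (hP : 1 ∉ P)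
    (hz : ∀ i a, a * z q γ i ∈ P → a ∈ P) {c : MvPolynomial (Fin n) K} (hc : c ≠ 0) (j : Fin n)
    (k : ℕ) : ofPoly hγ c * y q γ j ^ k ∉ P := by
  induction hN : c.support.card using Nat.strong_induction_on generalizing c j k with
  | _ N ih =>
  -- If `y_j` separated two monomials of `c`, the combination `y_j (c y_j ^ k) - l (c y_j ^ k) y_j`
  -- would be a shorter nonzero polynomial times `y_j ^ (k + 1)`. The exponent grows, which is why
  -- the induction ranges over all powers of `y_j`.
  have step : ∀ j k, ofPoly hγ c * y q γ j ^ k ∈ P → ∀ m ∈ c.support, ∀ m' ∈ c.support,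
      monomialWeight q (Pi.single j 1) m = monomialWeight q (Pi.single j 1) m' := by
    intro j k h m hm m' hm'
    by_contra hne
    let l := monomialWeight q (Pi.single j 1) m
    let b := (crossedData q γ).act (Pi.single j 1) c - l • c
    have hb : ∀ u, b.coeff u = (monomialWeight q (Pi.single j 1) u - l) * c.coeff u := by
      intro u
      rw [MvPolynomial.coeff_sub, coeff_act, MvPolynomial.coeff_smul, smul_eq_mul, sub_mul]
    refine ih b.support.card ?_ (c := b) (fun h0 ↦ ?_) j (k + 1) rfl ?_
    · rw [← hN]
      refine Finset.card_lt_card (Finset.ssubset_iff_subset_ne.2 ⟨fun u hu ↦ ?_, fun h ↦ ?_⟩)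
      · rw [MvPolynomial.mem_support_iff, hb] at hu
        exact MvPolynomial.mem_support_iff.2 (right_ne_zero_of_mul hu)
      · rw [← h, MvPolynomial.mem_support_iff, hb, sub_self, zero_mul] at hm
        exact hm rfl
    · have := hb m'
      rw [h0, MvPolynomial.coeff_zero, eq_comm, mul_eq_zero, sub_eq_zero] at this
      exact this.elim (fun h ↦ hne h.symm) (MvPolynomial.mem_support_iff.1 hm')
    · have : ofPoly hγ b * y q γ j ^ (k + 1) = y q γ j * (ofPoly hγ c * y q γ j ^ k) -
          l • (ofPoly hγ c * y q γ j ^ k * y q γ j) := by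
        rw [← mul_assoc, y_mul_ofPoly, map_sub, sub_mul, map_smul, mul_assoc _ (y q γ j),
          ← pow_succ', mul_assoc, ← pow_succ, smul_mul_assoc]
      rw [this]
      exact P.sub_mem (P.mul_mem_left _ _ h) (P.smul_mem_of_mem l (P.mul_mem_right _ _ h))
  intro h
  obtain ⟨m, hm⟩ := MvPolynomial.support_nonempty.2 hc
  -- All monomials of `c` share one eigenvalue under `y_j`, so the power of `y_j` can be removed.
  -- With exponent 0, `step` then applies to every other index and leaves only one monomial.
  have hmem : ofPoly hγ c ∈ P := by
    refine ofPoly_mem_of_act_eq hq hz (l := monomialWeight q (Pi.single j 1) m) ?_ k h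
    ext u
    rw [coeff_act, MvPolynomial.coeff_smul, smul_eq_mul]
    by_cases hu : u ∈ c.support
    · rw [step j k h u hu m hm]
    · rw [MvPolynomial.notMem_support_iff.1 hu, mul_zero, mul_zero]
  have hsupp : c = MvPolynomial.monomial m (c.coeff m) := by
    ext u
    rw [MvPolynomial.coeff_monomial]
    split_ifs with hu
    · rw [hu]
    · by_contra hu0
      obtain ⟨j', hj'⟩ := exists_monomialWeight_ne hq hu
      exact hj' (step j' 0 (by simpa using hmem) m hm u (MvPolynomial.mem_support_iff.2 hu0))
  rw [hsupp, ← mul_one (c.coeff m), ← smul_eq_mul, ← MvPolynomial.smul_monomial, map_smul] at hmem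
  refine hP (mem_of_mul_ofPoly_monomial_mem (hγ := hγ) hz m _ ?_)
  rw [one_mul]
  exact P.mem_of_smul_mem (MvPolynomial.mem_support_iff.1 hm) hmem

/-- Every nonzero prime ideal contains one of the `zᵢ`. -/
theorem exists_z_mem [NeZero n] (hγ : IsMulSkewSymm γ) (hq : ∀ i, ∀ m : ℕ, 0 < m → q i ^ m ≠ 1)
    (hP : P.IsPrimeIdeal) (hP0 : P ≠ ⊥) : ∃ i, z q γ i ∈ P := by
  by_contra! hz
  obtain ⟨a, ha, ha0⟩ : ∃ a ∈ P, a ≠ 0 := by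
    by_contra! h
    exact hP0 (eq_bot_iff.2 fun a ha ↦ by rw [TwoSidedIdeal.mem_bot]; exact h a ha)
  obtain ⟨c, hc, hcP⟩ := exists_ofPoly_mem hγ hq ha ha0
  -- With exponent 0 the index is immaterial; that an index `0` exists uses `n > 0`.
  refine ofPoly_mul_y_pow_notMem (hγ := hγ) hq (TwoSidedIdeal.one_notMem hP.1)
    (fun i a ↦ hP.mem_of_mul_mem (exists_mul_z_eq hγ i) (hz i)) hc 0 0 ?_
  rwa [pow_zero, mul_one]

end NonzeroIdeals

end QWeylAlgebra

theorem theorem3p1 {K : Type*} [Field K] (n : ℕ) (hn : 0 < n)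
    (q : Fin n → Kˣ) (γ : Fin n → Fin n → Kˣ) (hγ : IsMulSkewSymm γ)
    (hq : ∀ i, ∀ m : ℕ, 0 < m → q i ^ m ≠ 1) :
    {P : TwoSidedIdeal (QWeylAlgebra q γ) | P.IsHeightOnePrime} =
      Set.range fun i : Fin n => TwoSidedIdeal.span {QWeylAlgebra.z q γ i} := by
  have : NeZero n := ⟨hn.ne'⟩
  have hq1 : ∀ i, q i ≠ 1 := fun i ↦ by simpa using hq i 1 one_pos
  refine TwoSidedIdeal.setOf_isHeightOnePrime_eq_range _ (QWeylAlgebra.isPrimeIdeal_bot hγ hq1)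
    (QWeylAlgebra.isPrimeIdeal_span_z hγ hq1) (fun i h ↦ ?_) (fun i j h ↦ ?_) fun P hP hP0 ↦ ?_
  · have hz : QWeylAlgebra.z q γ i ∈ TwoSidedIdeal.span {QWeylAlgebra.z q γ i} :=
      TwoSidedIdeal.subset_span rfl
    rw [h, TwoSidedIdeal.mem_bot, ← map_eq_zero_iff _ (QWeylAlgebra.toCrossed_injective hγ hq1),
      QWeylAlgebra.toCrossed_z] at hz
    exact MvPolynomial.X_ne_zero i (Finsupp.single_eq_zero.1 hz)
  · exact ((QWeylAlgebra.z_mem_span_z_iff hγ hq1 j i).1 (h (TwoSidedIdeal.subset_span rfl))).symm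
  · obtain ⟨i, hi⟩ := QWeylAlgebra.exists_z_mem hγ hq hP hP0
    exact ⟨i, TwoSidedIdeal.span_le.2 (Set.singleton_subset_iff.2 hi)⟩
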